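/- Let $I\ge 2$ and let $\nu_1,\dots,\nu_I>0$ with $\sum_{i=1}^I\nu_i=1$ (the limiting group proportions). Put $$V=G_{I-1}\,\mathrm{diag}^{-1}(\nu_1,\dots,\nu_{I-1})\,G_{I-1}^T+\tfrac1{\nu_I}\,e_{I-1}e_{I-1}^T ,$$ where $G_{I-1}$ is the square matrix of order $I-1$ with $1$'s on the main diagonal, $-1$'s on the superdiagonal and $0$ elsewhere, and $e_{I-1}$ is the last unit vector of $\mathbb R^{I-1}$. Let $Z\sim\mathcal N_{I-1}(0,V)$ and $\mathbb R_+^{I-1}=\{\zeta\in\mathbb R^{I-1}:\zeta\ge 0\}$. Then $V$ is positive definite, and the chi-bar-square distribution of $V$, i.e. the law of $$\bar\chi^2=Z^TV^{-1}Z-\min_{\zeta\in\mathbb R_+^{I-1}}(Z-\zeta)^TV^{-1}(Z-\zeta),$$ satisfies, for exactly one family of real numbers $w_0,\dots,w_{I-1}$ with $\sum_i w_i=1$, $$\Pr(\bar\chi^2\le x)=\sum_{i=0}^{I-1}w_i\,\Pr(\chi^2_i\le x)\quad\text{for all }x\in\mathbb R$$ ($\chi^2_0$ is the point mass at $0$).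 These chi-bar-square weights $w_i=w_i(I-1,V)$ are $$w_i(I-1,V)=\Pr\Bigl(\arg\min_{\zeta\in\mathbb R_+^{I-1}}(Z-\zeta)^TV^{-1}(Z-\zeta)\in\mathbb R_+^{I-1}(i)\Bigr),\qquad i=0,\dots,I-1,$$ where the minimizer is unique for every value of $Z$, and $\mathbb R_+^{I-1}(i)$ is the set of points of $\mathbb R_+^{I-1}$ with exactly $i$ strictly positive components. In particular, with $\rho_{ij}=V_{ij}/\sqrt{V_{ii}V_{jj}}$ and $\rho_{ij\bullet k}=(\rho_{ij}-\rho_{ik}\rho_{jk})/\sqrt{(1-\rho_{ik}^2)(1-\rho_{jk}^2)}$: - for $I=2$: $w_0=w_1=\tfrac12$; - for $I=3$: $w_0=\tfrac1{2\pi}\arccos\rho_{12}$, $w_1=\tfrac12$, $w_2=\tfrac12-\tfrac1{2\pi}\arccos\rho_{12}$; - for $I=4$: $w_3=\tfrac1{4\pi}(2\pi-\arccos\rho_{12}-\arccos\rho_{13}-\arccos\rho_{23})$, $w_2=\tfrac1{4\pi}(3\pi-\arccos\rho_{12\bullet3}-\arccos\rho_{13\bullet2}-\arccos\rho_{23\bullet1})$,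 $w_1=\tfrac12-w_3$, $w_0=\tfrac12-w_2$. -/

import Mathlib

open MeasureTheory ProbabilityTheory

noncomputable section

/-- `G_p`: the square matrix with `1` on the diagonal and `-1` on the superdiagonal. -/
def diffMatrix (p : ℕ) : Matrix (Fin p) (Fin p) ℝ :=
  Matrix.of fun i j => if j = i then 1 else if (j : ℕ) = (i : ℕ) + 1 then -1 else 0

/-- `e_p`: the last vector of the canonical basis of `ℝ^p`. -/
def lastUnit (p : ℕ) : Fin p → ℝ := fun i => if (i : ℕ) + 1 = p then 1 else 0

/-- `V = G diag⁻¹(ν₁, …, ν_p) Gᵀ + (1 / ν_{p+1}) e eᵀ`, where `p = I - 1` and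
`ν = (ν₁, …, ν_I)` is the vector of limiting group proportions. -/
def covV {p : ℕ} (ν : Fin (p + 1) → ℝ) : Matrix (Fin p) (Fin p) ℝ :=
  diffMatrix p * (Matrix.diagonal fun i : Fin p => ν i.castSucc)⁻¹ * (diffMatrix p).transpose
    + (1 / ν (Fin.last p)) • Matrix.vecMulVec (lastUnit p) (lastUnit p)

/-- The squared length `xᵀ V⁻¹ x`. -/
def invQuad {p : ℕ} (V : Matrix (Fin p) (Fin p) ℝ) (x : EuclideanSpace ℝ (Fin p)) : ℝ :=
  x.ofLp ⬝ᵥ Matrix.mulVec V⁻¹ x.ofLp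

/-- The nonnegative orthant of `ℝ^p`. -/
def orthant (p : ℕ) : Set (EuclideanSpace ℝ (Fin p)) := {ζ | ∀ j, 0 ≤ ζ j}

/-- The points of the nonnegative orthant with exactly `i` strictly positive components
(the other `p - i` components are zero). -/
def orthantFace (p i : ℕ) : Set (EuclideanSpace ℝ (Fin p)) :=
  {ζ | ζ ∈ orthant p ∧ (Finset.univ.filter fun j => 0 < ζ j).card = i}

/-- `ζ` minimizes `(z - ξ)ᵀ V⁻¹ (z - ξ)` over `ξ` in the nonnegative orthant. -/
def IsOrthantProj {p : ℕ} (V : Matrix (Fin p) (Fin p) ℝ) (z ζ : EuclideanSpace ℝ (Fin p)) : Prop :=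
  ζ ∈ orthant p ∧ IsMinOn (fun ξ => invQuad V (z - ξ)) (orthant p) ζ

/-- The probability that, for `Z ∼ N_p(0, V)`, the `V⁻¹`-metric projection of `Z` onto the
nonnegative orthant has exactly `i` strictly positive components. -/
def projWeight {p : ℕ} (V : Matrix (Fin p) (Fin p) ℝ) (i : ℕ) : ℝ :=
  (multivariateGaussian 0 V).real {z | ∃ ζ ∈ orthantFace p i, IsOrthantProj V z ζ}

/-- The chi-square law with `k` degrees of freedom: the law of the sum of the squares of `k`
independent standard normal variables. For `k = 0` it is the point mass at `0`. -/
def chiSquareLaw (k : ℕ) : Measure ℝ :=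
  (Measure.pi fun _ : Fin k => gaussianReal 0 1).map fun x => ∑ j, x j ^ 2

/-- The chi-bar-square statistic of `z` for the nonnegative orthant:
`zᵀ V⁻¹ z - min_{ζ ≥ 0} (z - ζ)ᵀ V⁻¹ (z - ζ)`. -/
def chiBarStat {p : ℕ} (V : Matrix (Fin p) (Fin p) ℝ) (z : EuclideanSpace ℝ (Fin p)) : ℝ :=
  invQuad V z - ⨅ ζ : orthant p, invQuad V (z - ζ)

/-- `w₀, …, w_p` are chi-bar-square weights for `V`: they sum to one, and the chi-bar-square
distribution, that is, the law of the chi-bar-square statistic of `Z ∼ N_p(0, V)`, is the mixture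
of the chi-square laws with `0, …, p` degrees of freedom with these weights. -/
def IsChiBarSquareWeights {p : ℕ} (V : Matrix (Fin p) (Fin p) ℝ) (w : Fin (p + 1) → ℝ) : Prop :=
  ∑ i, w i = 1 ∧
    ∀ x : ℝ, (multivariateGaussian 0 V).real {z | chiBarStat V z ≤ x} =
      ∑ i : Fin (p + 1), w i * (chiSquareLaw i).real (Set.Iic x)

/-- The correlation coefficient `ρ_{ij}` of the covariance matrix `V`. -/
def corr {p : ℕ} (V : Matrix (Fin p) (Fin p) ℝ) (i j : Fin p) : ℝ :=
  V i j / Real.sqrt (V i i * V j j)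

/-- The partial correlation coefficient `ρ_{ij·k}` of the covariance matrix `V`. -/
def partialCorr {p : ℕ} (V : Matrix (Fin p) (Fin p) ℝ) (i j k : Fin p) : ℝ :=
  (corr V i j - corr V i k * corr V j k) /
    Real.sqrt ((1 - corr V i k ^ 2) * (1 - corr V j k ^ 2))

/-- Limiting group proportions: positive numbers that sum to one. -/
def IsProportions {n : ℕ} (ν : Fin n → ℝ) : Prop := (∀ i, 0 < ν i) ∧ ∑ i, ν i = 1

end

/-!
Write `Z = V^{1/2} X` with `X` standard Gaussian. This map turns the length given by `V⁻¹` into the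
Euclidean length and the orthant into the cone `{x | ∀ j, 0 ≤ ⟪r j, x⟫}`, where the vectors `r j`
are the rows of `V^{1/2}` and have Gram matrix `V`. By Moreau's decomposition the chi-bar-square
statistic is the squared length of the projection of `X` onto this cone.

The space is partitioned according to the face that contains the projection. If this is the face of
`S`, the projection onto the cone is the orthogonal projection onto the span of that face
(`IsConeProj.eq_starProjection`), so the region belonging to `S` is described by a cone condition on
the component of `X` in the span and a separate condition on the orthogonal component
(`faceRegion_eq`). These components are independent, and the length of a Gaussian vector is
independent of its direction (`stdGaussian_cone_inter_ball`); so, on this region, the squared length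
of the projection is chi-square with `S.card` degrees of freedom
(`stdGaussian_projection_cone_inter_ball`). Summing over the faces gives the mixture, with the
weights `projWeight`. The weights are unique because the chi-square distribution functions are
linearly independent (`chiSquareLaw_linearIndependent`).

In dimension at most three, every face probability that is needed is the probability that up to
three linear functionals of `X` are all positive. For two functionals this is an angle in the plane
(`stdGaussian_orthant_two`), and the case of three follows by inclusion-exclusion
(`stdGaussian_orthant_three`). For the regions, the Karush-Kuhn-Tucker conditions
(`mem_faceRegion_iff`) provide the functionals, and the functional of the projection is orthogonal
to those of the multipliers. The region of the vertex is obtained from the total mass.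
-/

open MeasureTheory ProbabilityTheory InnerProductGeometry Filter
open scoped RealInnerProductSpace MatrixOrder Topology

/-! ### Radial symmetry of the Gaussian product measure -/

/-- The density of the standard Gaussian product measure is radial. Only this is used of it, so the
normalizing constant is left unspecified. -/
lemma pi_gaussianReal_eq_withDensity (n : ℕ) :
    ∃ c : ℝ, (Measure.pi fun _ : Fin n => gaussianReal 0 1) =
      volume.withDensity fun x => ENNReal.ofReal (c * Real.exp (-(∑ j, x j ^ 2) / 2)) := by
  refine ⟨(√(2 * Real.pi * 1))⁻¹ ^ n, ?_⟩
  have hprod : ∀ x : Fin n → ℝ, (√(2 * Real.pi * 1))⁻¹ ^ n * Real.exp (-(∑ j, x j ^ 2) / 2)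
      = ∏ j, gaussianPDFReal 0 1 (x j) := by
    intro x
    simp [gaussianPDFReal, Finset.prod_mul_distrib, ← Real.exp_sum, Finset.sum_div,
      Finset.sum_neg_distrib, neg_div]
  refine Measure.pi_eq fun s hs => ?_
  rw [withDensity_apply _ (MeasurableSet.univ_pi hs), volume_pi, Measure.restrict_pi_pi]
  simp_rw [hprod]
  rw [← ofReal_integral_eq_lintegral_ofReal]
  · rw [integral_fintype_prod_eq_prod (f := fun _ => gaussianPDFReal 0 1),
      ENNReal.ofReal_prod_of_nonneg]
    · refine Finset.prod_congr rfl fun i _ => ?_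
      rw [gaussianReal_apply_eq_integral 0 one_ne_zero]
    · exact fun i _ => integral_nonneg (gaussianPDFReal_nonneg _ _)
  · exact Integrable.fintype_prod (f := fun _ => gaussianPDFReal 0 1)
      fun i => (integrable_gaussianPDFReal _ _).restrict
  · exact ae_of_all _ fun x => Finset.prod_nonneg fun i _ => gaussianPDFReal_nonneg _ _ _

/-- The volume of the part of a cone inside a ball scales with the radius exactly as the volume of
the ball does. -/
lemma volume_cone_inter_ball {n : ℕ} {C : Set (Fin n → ℝ)}
    (hC : ∀ t : ℝ, 0 < t → ∀ x, t • x ∈ C ↔ x ∈ C) {r : ℝ} (hr : 0 < r) :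
    volume (C ∩ {x | ∑ j, x j ^ 2 ≤ r}) =
      ENNReal.ofReal (√r ^ n) * volume (C ∩ {x | ∑ j, x j ^ 2 ≤ 1}) := by
  have hs : 0 < √r := Real.sqrt_pos.2 hr
  have : C ∩ {x : Fin n → ℝ | ∑ j, x j ^ 2 ≤ r} =
      ((√r)⁻¹ • ·) ⁻¹' (C ∩ {x | ∑ j, x j ^ 2 ≤ 1}) := by
    ext x
    simp only [Set.mem_inter_iff, Set.mem_ofPred_eq, Set.mem_preimage, hC _ (inv_pos.2 hs),
      Pi.smul_apply, smul_eq_mul, mul_pow, ← Finset.mul_sum, inv_pow, Real.sq_sqrt hr.le]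
    rw [inv_mul_le_iff₀ hr, mul_one]
  rw [this, Measure.addHaar_preimage_smul _ (inv_ne_zero hs.ne')]
  simp [abs_of_nonneg (pow_nonneg hs.le n)]

lemma volume_ball_lt_top (n : ℕ) (r : ℝ) :
    volume {x : Fin n → ℝ | ∑ j, x j ^ 2 ≤ r} < ⊤ := by
  refine lt_of_le_of_lt (measure_mono (t := Metric.closedBall 0 (√r)) fun x hx => ?_)
    measure_closedBall_lt_top
  rw [mem_closedBall_zero_iff, pi_norm_le_iff_of_nonneg (Real.sqrt_nonneg _)]
  intro i
  rw [Real.norm_eq_abs]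
  exact Real.abs_le_sqrt
    ((Finset.single_le_sum (f := fun j => x j ^ 2) (fun j _ => sq_nonneg _)
      (Finset.mem_univ i)).trans hx)

lemma measurable_sum_sq (n : ℕ) : Measurable fun x : Fin n → ℝ => ∑ j, x j ^ 2 := by fun_prop

/-- Restricting Lebesgue measure to a cone changes the distribution of the squared length only by a
constant factor: the ratio of the volumes of the cone and of the whole space inside the unit ball.
The dimension is nonzero, so that `{0}` is a null set. -/
lemma volume_ball_smul_map_cone {n : ℕ} (hn : n ≠ 0) {C : Set (Fin n → ℝ)}
    (hC : ∀ t : ℝ, 0 < t → ∀ x, t • x ∈ C ↔ x ∈ C) :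
    (volume {x : Fin n → ℝ | ∑ j, x j ^ 2 ≤ 1}) •
        (volume.restrict C).map (fun x => ∑ j, x j ^ 2) =
      (volume (C ∩ {x | ∑ j, x j ^ 2 ≤ 1})) • volume.map (fun x : Fin n → ℝ => ∑ j, x j ^ 2) := by
  have hq := measurable_sum_sq n
  have hlt : ∀ r, (volume.map (fun x : Fin n → ℝ => ∑ j, x j ^ 2)) (Set.Iic r) < ⊤ := by
    intro r
    rw [Measure.map_apply hq measurableSet_Iic]
    exact volume_ball_lt_top n r
  have hle : ∀ D : Set (Fin n → ℝ), (volume.restrict D).map (fun x : Fin n → ℝ => ∑ j, x j ^ 2) ≤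
      volume.map (fun x : Fin n → ℝ => ∑ j, x j ^ 2) :=
    fun D => Measure.map_mono Measure.restrict_le_self hq
  -- on left-infinite intervals both sides are a power of `√r` times a constant
  have hIic : ∀ r : ℝ, ∀ D : Set (Fin n → ℝ), (∀ t : ℝ, 0 < t → ∀ x, t • x ∈ D ↔ x ∈ D) →
      ((volume.restrict D).map (fun x => ∑ j, x j ^ 2)) (Set.Iic r) =
        ENNReal.ofReal (√r ^ n) * volume (D ∩ {x | ∑ j, x j ^ 2 ≤ 1}) := by
    intro r D hD
    rw [Measure.map_apply hq measurableSet_Iic,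
      Measure.restrict_apply (hq measurableSet_Iic), Set.inter_comm]
    rcases lt_or_ge 0 r with hr | hr
    · exact volume_cone_inter_ball hD hr
    · rw [Real.sqrt_eq_zero_of_nonpos hr, zero_pow hn, ENNReal.ofReal_zero, zero_mul]
      have : Nonempty (Fin n) := ⟨⟨0, Nat.pos_of_ne_zero hn⟩⟩
      refine measure_mono_null (t := {0}) (fun x hx => ?_) (measure_singleton _)
      have h0 : ∑ j, x j ^ 2 ≤ 0 := le_trans hx.2 hr
      have h1 := (Finset.sum_eq_zero_iff_of_nonneg (fun j _ => sq_nonneg (x j))).1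
        (le_antisymm h0 (Finset.sum_nonneg fun j _ => sq_nonneg _))
      ext j
      simpa using h1 j (Finset.mem_univ j)
  have hB := volume_ball_lt_top n 1
  have hCB : volume (C ∩ {x | ∑ j, x j ^ 2 ≤ 1}) < ⊤ :=
    (measure_mono Set.inter_subset_right).trans_lt hB
  have hloc : ∀ (c : ENNReal) (ν : Measure ℝ), c < ⊤ → (∀ r, ν (Set.Iic r) < ⊤) →
      IsLocallyFiniteMeasure (c • ν) := by
    intro c ν hc hν
    refine ⟨fun x => ⟨Set.Iic (x + 1), Iic_mem_nhds (by linarith), ?_⟩⟩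
    simpa using ENNReal.mul_lt_top hc (hν _)
  have hlt' : ∀ r,
      ((volume.restrict C).map (fun x : Fin n → ℝ => ∑ j, x j ^ 2)) (Set.Iic r) < ⊤ :=
    fun r => (hle C _).trans_lt (hlt r)
  have := hloc _ _ hB hlt'
  refine Measure.ext_of_Ioc _ _ fun a b hab => ?_
  have hkey : ∀ r, ((volume {x : Fin n → ℝ | ∑ j, x j ^ 2 ≤ 1}) •
        (volume.restrict C).map (fun x => ∑ j, x j ^ 2)) (Set.Iic r) =
      ((volume (C ∩ {x | ∑ j, x j ^ 2 ≤ 1})) • volume.map (fun x : Fin n → ℝ => ∑ j, x j ^ 2))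
        (Set.Iic r) := by
    intro r
    have h2 := hIic r Set.univ (by simp)
    rw [Measure.restrict_univ, Set.univ_inter] at h2
    simp only [Measure.smul_apply, smul_eq_mul, hIic r C hC, h2]
    ring
  rw [← Set.Iic_sdiff_Iic,
    measure_sdiff (Set.Iic_subset_Iic.2 hab.le) measurableSet_Iic.nullMeasurableSet,
    measure_sdiff (Set.Iic_subset_Iic.2 hab.le) measurableSet_Iic.nullMeasurableSet, hkey, hkey]
  · simpa using (ENNReal.mul_lt_top hCB (hlt _)).ne
  · simpa using (ENNReal.mul_lt_top hB (hlt' _)).ne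

/-- For a standard Gaussian vector in coordinates, the event of lying in a cone is independent of
the squared length: the density is a function of the squared length, whose distribution under Lebesgue
measure restricted to the cone is proportional to the unrestricted one. -/
lemma pi_gaussianReal_cone_inter {n : ℕ} {C : Set (Fin n → ℝ)} (hm : MeasurableSet C)
    (hC : ∀ t : ℝ, 0 < t → ∀ x, t • x ∈ C ↔ x ∈ C) (t : ℝ) :
    (Measure.pi fun _ : Fin n => gaussianReal 0 1) (C ∩ {x | ∑ j, x j ^ 2 ≤ t}) =
      (Measure.pi fun _ : Fin n => gaussianReal 0 1) C * chiSquareLaw n (Set.Iic t) := by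
  have hq := measurable_sum_sq n
  rw [chiSquareLaw, Measure.map_apply hq measurableSet_Iic]
  change _ = _ * (Measure.pi fun _ : Fin n => gaussianReal 0 1) {x | ∑ j, x j ^ 2 ≤ t}
  -- in dimension zero the squared length has an atom at `0` and every cone is trivial
  rcases eq_or_ne n 0 with rfl | hn
  · rcases Set.eq_empty_or_nonempty C with rfl | hne
    · simp
    · rw [Subsingleton.eq_univ_of_nonempty hne]
      simp
  obtain ⟨c, hc⟩ := pi_gaussianReal_eq_withDensity n
  have hdens : ∀ (D : Set (Fin n → ℝ)), MeasurableSet D → ∀ B : Set ℝ, MeasurableSet B →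
      (Measure.pi fun _ : Fin n => gaussianReal 0 1) (D ∩ {x | ∑ j, x j ^ 2 ∈ B}) =
        ∫⁻ s in B, ENNReal.ofReal (c * Real.exp (-s / 2))
          ∂((volume.restrict D).map (fun x => ∑ j, x j ^ 2)) := by
    intro D hD B hB
    have hmeas : Measurable fun s : ℝ => ENNReal.ofReal (c * Real.exp (-s / 2)) := by fun_prop
    have hset : D ∩ {x : Fin n → ℝ | ∑ j, x j ^ 2 ∈ B} = (fun x => ∑ j, x j ^ 2) ⁻¹' B ∩ D :=
      Set.inter_comm _ _
    rw [setLIntegral_map hB hmeas hq, Measure.restrict_restrict (hq hB), hc, hset,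
      withDensity_apply _ ((hq hB).inter hD)]
  set γ := Measure.pi fun _ : Fin n => gaussianReal 0 1 with hγ
  set b := volume {x : Fin n → ℝ | ∑ j, x j ^ 2 ≤ 1} with hb
  set k := volume (C ∩ {x | ∑ j, x j ^ 2 ≤ 1}) with hk
  have hprop : ∀ B : Set ℝ, MeasurableSet B →
      b * γ (C ∩ {x | ∑ j, x j ^ 2 ∈ B}) = k * γ {x | ∑ j, x j ^ 2 ∈ B} := by
    intro B hB
    have h2 := hdens Set.univ MeasurableSet.univ B hB
    rw [Measure.restrict_univ, Set.univ_inter] at h2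
    rw [hdens C hm B hB, h2, ← smul_eq_mul, ← smul_eq_mul, ← lintegral_smul_measure,
      ← lintegral_smul_measure, ← Measure.restrict_smul, ← Measure.restrict_smul,
      volume_ball_smul_map_cone hn hC]
  -- the unit ball contains a cube of half-side `1 / n`, as `n * (1 / n) ^ 2 ≤ 1`
  have hb0 : b ≠ 0 := by
    have : Metric.ball (0 : Fin n → ℝ) (1 / n) ⊆ {x : Fin n → ℝ | ∑ j, x j ^ 2 ≤ 1} := by
      intro x hx
      have hn' : (1 : ℝ) ≤ n := by exact_mod_cast Nat.one_le_iff_ne_zero.2 hn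
      have h1 : ∀ j, x j ^ 2 ≤ 1 / n := by
        intro j
        have h2 : |x j| ≤ 1 / n := (norm_le_pi_norm x j).trans (mem_ball_zero_iff.1 hx).le
        have h3 : (1 : ℝ) / n ≤ 1 := by rw [div_le_one (by linarith)]; exact hn'
        rw [← sq_abs]
        nlinarith [abs_nonneg (x j)]
      calc ∑ j, x j ^ 2 ≤ ∑ j : Fin n, (1 : ℝ) / n := Finset.sum_le_sum fun j _ => h1 j
        _ = 1 := by simp [hn]
    refine ((Metric.measure_ball_pos volume (0 : Fin n → ℝ) ?_).trans_le (measure_mono this)).ne'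
    have : 0 < (n : ℝ) := by exact_mod_cast Nat.pos_of_ne_zero hn
    positivity
  have hbt : b ≠ ⊤ := (volume_ball_lt_top n 1).ne
  have h1 := hprop Set.univ MeasurableSet.univ
  have h2 := hprop (Set.Iic t) measurableSet_Iic
  have huniv : γ Set.univ = 1 := measure_univ
  simp only [Set.mem_univ, Set.ofPred_true, Set.inter_univ, huniv, mul_one, Set.mem_Iic] at h1 h2
  rw [← h1, mul_assoc] at h2
  exact (ENNReal.mul_right_inj hb0 hbt).1 h2

/-! ### Standard Gaussian vectors: cones, projections, Gram matrices -/

section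
variable {E : Type*} [NormedAddCommGroup E] [InnerProductSpace ℝ E] [FiniteDimensional ℝ E]
  [MeasurableSpace E] [BorelSpace E]

/-- The event that a standard Gaussian vector lies in a cone is independent of its squared length,
which is chi-square distributed. -/
lemma stdGaussian_cone_inter_ball {C : Set E} (hm : MeasurableSet C)
    (hC : ∀ t : ℝ, 0 < t → ∀ x, t • x ∈ C ↔ x ∈ C) (t : ℝ) :
    stdGaussian E (C ∩ {x | ‖x‖ ^ 2 ≤ t}) =
      stdGaussian E C * chiSquareLaw (Module.finrank ℝ E) (Set.Iic t) := by
  set f : (Fin (Module.finrank ℝ E) → ℝ) → E := fun x => ∑ i, x i • stdOrthonormalBasis ℝ E i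
  have hf : Measurable f := by fun_prop
  have hball : MeasurableSet {x : E | ‖x‖ ^ 2 ≤ t} := measurableSet_le (by fun_prop) (by fun_prop)
  have hnorm : ∀ x, ‖f x‖ ^ 2 = ∑ i, x i ^ 2 := by
    intro x
    rw [← real_inner_self_eq_norm_sq, (stdOrthonormalBasis ℝ E).orthonormal.inner_sum]
    simp [sq]
  rw [stdGaussian, Measure.map_apply hf (hm.inter hball), Measure.map_apply hf hm,
    ← pi_gaussianReal_cone_inter (hf hm)]
  · congr 1
    ext x
    simp [hnorm]
  · intro t ht x
    have : f (t • x) = t • f x := by simp [f, Finset.smul_sum, mul_smul]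
    simp only [Set.mem_preimage, this, hC t ht]

lemma stdGaussian_map_orthogonalProjection (L : Submodule ℝ E) :
    (stdGaussian E).map L.orthogonalProjectionOnto = stdGaussian L := by
  apply Measure.ext_of_charFun
  ext t
  have h : charFun ((stdGaussian E).map L.orthogonalProjectionOnto) t =
      charFun (stdGaussian E) (t : E) := by
    rw [charFun_apply, charFun_apply, integral_map (by fun_prop) (by fun_prop)]
    refine integral_congr_ae (ae_of_all _ fun x => ?_)
    simp only
    rw [Submodule.coe_inner, Submodule.coe_orthogonalProjectionOnto_apply,
      Submodule.inner_starProjection_left_eq_right, Submodule.starProjection_eq_self_iff.2 t.2]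
  rw [h, charFun_stdGaussian, charFun_stdGaussian, Submodule.coe_norm]

lemma indepFun_starProjection_stdGaussian (L : Submodule ℝ E) :
    IndepFun (fun x => L.orthogonalProjectionOnto x) (fun x => Lᗮ.orthogonalProjectionOnto x)
      (stdGaussian E) := by
  have : HasGaussianLaw (fun x : E =>
      (L.orthogonalProjectionOnto x, Lᗮ.orthogonalProjectionOnto x))
      (stdGaussian E) :=
    (IsGaussian.hasGaussianLaw_id (μ := stdGaussian E)).map
      (L.orthogonalProjectionOnto.prod Lᗮ.orthogonalProjectionOnto)
  refine this.indepFun_of_covariance_inner fun x y => ?_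
  have h1 : ∀ u : E, ⟪x, L.orthogonalProjectionOnto u⟫ = ⟪(x : E), u⟫ := by
    intro u
    rw [Submodule.coe_inner, Submodule.coe_orthogonalProjectionOnto_apply,
      ← Submodule.inner_starProjection_left_eq_right, Submodule.starProjection_eq_self_iff.2 x.2]
  have h2 : ∀ u : E, ⟪y, Lᗮ.orthogonalProjectionOnto u⟫ = ⟪(y : E), u⟫ := by
    intro u
    rw [Submodule.coe_inner, Submodule.coe_orthogonalProjectionOnto_apply,
      ← Submodule.inner_starProjection_left_eq_right, Submodule.starProjection_eq_self_iff.2 y.2]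
  simp_rw [h1, h2]
  rw [← covarianceBilin_apply_eq_cov IsGaussian.memLp_two_id, covarianceBilin_stdGaussian,
    innerSL_apply_apply]
  exact y.2 x x.2

/-- Let `X` be standard Gaussian. On the event that the projection of `X` onto `L` lies in a cone
`C` and the remainder in `D`, the squared length of the projection is still chi-square with `dim L`
degrees of freedom: the remainder is independent of the projection, and the squared length of the
projection is independent of its direction. -/
lemma stdGaussian_projection_cone_inter_ball (L : Submodule ℝ E) {C D : Set E}
    (hm : MeasurableSet C) (hD : MeasurableSet D)
    (hC : ∀ t : ℝ, 0 < t → ∀ x, t • x ∈ C ↔ x ∈ C) (t : ℝ) :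
    stdGaussian E {x | (L.starProjection x ∈ C ∧ x - L.starProjection x ∈ D) ∧
        ‖L.starProjection x‖ ^ 2 ≤ t} =
      stdGaussian E {x | L.starProjection x ∈ C ∧ x - L.starProjection x ∈ D} *
        chiSquareLaw (Module.finrank ℝ L) (Set.Iic t) := by
  have hsub : ∀ x : E, x - L.starProjection x = (Lᗮ.orthogonalProjectionOnto x : E) := by
    intro x
    simp [Submodule.starProjection_orthogonal]
  have hC' : MeasurableSet ((↑) ⁻¹' C : Set L) := measurable_subtype_coe hm
  have hD' : MeasurableSet ((↑) ⁻¹' D : Set Lᗮ) := measurable_subtype_coe hD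
  have hball : MeasurableSet {x : L | ‖x‖ ^ 2 ≤ t} := measurableSet_le (by fun_prop) (by fun_prop)
  have hind := indepFun_starProjection_stdGaussian L
  have e1 : {x | (L.starProjection x ∈ C ∧ x - L.starProjection x ∈ D) ∧
        ‖L.starProjection x‖ ^ 2 ≤ t} =
      L.orthogonalProjectionOnto ⁻¹' ((↑) ⁻¹' C ∩ {x : L | ‖x‖ ^ 2 ≤ t}) ∩
        Lᗮ.orthogonalProjectionOnto ⁻¹' ((↑) ⁻¹' D) := by
    ext x
    simp only [hsub, Set.mem_ofPred_eq, Set.mem_inter_iff, Set.mem_preimage,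
      Submodule.coe_orthogonalProjectionOnto_apply, Submodule.coe_norm]
    tauto
  have e2 : {x | L.starProjection x ∈ C ∧ x - L.starProjection x ∈ D} =
      L.orthogonalProjectionOnto ⁻¹' ((↑) ⁻¹' C) ∩ Lᗮ.orthogonalProjectionOnto ⁻¹' ((↑) ⁻¹' D) := by
    ext x
    simp only [hsub, Set.mem_ofPred_eq, Set.mem_inter_iff, Set.mem_preimage,
      Submodule.coe_orthogonalProjectionOnto_apply]
  rw [e1, e2, hind.measure_inter_preimage_eq_mul _ _ (hC'.inter hball) hD',
    hind.measure_inter_preimage_eq_mul _ _ hC' hD',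
    ← Measure.map_apply (by fun_prop) (hC'.inter hball), ← Measure.map_apply (by fun_prop) hC',
    stdGaussian_map_orthogonalProjection, stdGaussian_cone_inter_ball hC']
  · ring
  · intro s hs x
    simpa using hC s hs x

lemma stdGaussian_hyperplane {a : E} (ha : a ≠ 0) : stdGaussian E {x | ⟪a, x⟫ = 0} = 0 := by
  have h := IsGaussian.map_eq_gaussianReal (μ := stdGaussian E) (innerSL ℝ a)
  rw [variance_dual_stdGaussian] at h
  have hv : (‖innerSL ℝ a‖ ^ 2).toNNReal ≠ 0 := by
    simp [ha]
  have := nullSingletonClass_gaussianReal (μ := (stdGaussian E)[innerSL ℝ a]) hv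
  have h0 : ((stdGaussian E).map (innerSL ℝ a)) {0} = 0 := by
    rw [h]; exact measure_singleton 0
  rw [Measure.map_apply (by fun_prop) (measurableSet_singleton _)] at h0
  exact h0

lemma charFun_stdGaussian_map_inner {ι : Type*} [Fintype ι] (c : ι → E)
    (t : EuclideanSpace ℝ ι) :
    charFun ((stdGaussian E).map (fun x => WithLp.toLp 2 fun i => ⟪c i, x⟫)) t =
      Complex.exp (-((∑ i, ∑ j, t i * t j * ⟪c i, c j⟫ : ℝ) : ℂ) / 2) := by
  have e : ‖∑ i, t i • c i‖ ^ 2 = ∑ i, ∑ j, t i * t j * ⟪c i, c j⟫ := by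
    rw [← real_inner_self_eq_norm_sq, sum_inner]
    simp_rw [inner_sum, real_inner_smul_left, real_inner_smul_right]
    refine Finset.sum_congr rfl fun i _ => Finset.sum_congr rfl fun j _ => by ring
  have h1 : charFun ((stdGaussian E).map (fun x => WithLp.toLp 2 fun i => ⟪c i, x⟫)) t =
      charFun (stdGaussian E) (∑ i, t i • c i) := by
    rw [charFun_apply, charFun_apply, integral_map (Measurable.aemeasurable (by fun_prop))
      (Measurable.aestronglyMeasurable (by fun_prop))]
    refine integral_congr_ae (ae_of_all _ fun x => ?_)
    simp only
    congr 3
    simp [PiLp.inner_apply, inner_sum, real_inner_smul_right, real_inner_comm]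
  rw [h1, charFun_stdGaussian, ← e]
  push_cast
  rfl

/-- The joint law of finitely many linear functionals of a standard Gaussian vector depends only
on the Gram matrix of the vectors that represent them. -/
lemma stdGaussian_map_inner_congr {F ι : Type*} [Fintype ι] [NormedAddCommGroup F]
    [InnerProductSpace ℝ F] [FiniteDimensional ℝ F] [MeasurableSpace F] [BorelSpace F]
    (a : ι → E) (b : ι → F) (h : ∀ i j, ⟪a i, a j⟫ = ⟪b i, b j⟫) :
    (stdGaussian E).map (fun x => WithLp.toLp 2 fun i => ⟪a i, x⟫) =
      (stdGaussian F).map (fun x => WithLp.toLp 2 fun i => ⟪b i, x⟫) := by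
  apply Measure.ext_of_charFun
  ext t
  rw [charFun_stdGaussian_map_inner a, charFun_stdGaussian_map_inner b]
  simp_rw [h]
end

/-! ### Gaussian probabilities of intersections of two and three half-spaces -/

lemma measurableSet_pos_and_pos {α : Type*} [MeasurableSpace α] {f g : α → ℝ} (hf : Measurable f)
    (hg : Measurable g) : MeasurableSet {x | 0 < f x ∧ 0 < g x} :=
  (measurableSet_lt measurable_const hf).inter (measurableSet_lt measurable_const hg)

/-- In the plane, the Gaussian measure of a cone is proportional to its angular measure (polar
coordinates). The constant is `1 / (2 * π)`, as the cone `univ` shows. -/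
lemma exists_pi_gaussianReal_planar_cone :
    ∃ K : ENNReal, ∀ D : Set (Fin 2 → ℝ), MeasurableSet D →
      (∀ t : ℝ, 0 < t → ∀ x, t • x ∈ D ↔ x ∈ D) →
      (Measure.pi fun _ : Fin 2 => gaussianReal 0 1) D =
        K * volume ({θ | ![Real.cos θ, Real.sin θ] ∈ D} ∩ Set.Ioo (-Real.pi) Real.pi) := by
  obtain ⟨c, hc⟩ := pi_gaussianReal_eq_withDensity 2
  refine ⟨∫⁻ r in Set.Ioi (0 : ℝ), ENNReal.ofReal r * ENNReal.ofReal (c * Real.exp (-r ^ 2 / 2)),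
    fun D hD hcone => ?_⟩
  have hΘ : MeasurableSet {θ : ℝ | ![Real.cos θ, Real.sin θ] ∈ D} := by
    have : Measurable fun θ : ℝ => ![Real.cos θ, Real.sin θ] := by
      refine measurable_pi_iff.2 fun i => ?_
      fin_cases i
      · exact Real.measurable_cos
      · exact Real.measurable_sin
    exact this hD
  rw [hc, withDensity_apply _ hD, ← lintegral_indicator hD,
    ← (volume_preserving_finTwoArrow ℝ).symm.lintegral_comp
      (Measurable.indicator (by fun_prop) hD),
    ← lintegral_comp_polarCoord_symm]
  have htarget : polarCoord.target = Set.Ioi (0 : ℝ) ×ˢ Set.Ioo (-Real.pi) Real.pi := rfl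
  have hcongr : ∀ p ∈ polarCoord.target,
      ENNReal.ofReal p.1 • (D.indicator
        (fun x : Fin 2 → ℝ => ENNReal.ofReal (c * Real.exp (-(∑ j, x j ^ 2) / 2)))
        (MeasurableEquiv.finTwoArrow.symm (polarCoord.symm p))) =
      (ENNReal.ofReal p.1 * ENNReal.ofReal (c * Real.exp (-p.1 ^ 2 / 2))) *
        {θ : ℝ | ![Real.cos θ, Real.sin θ] ∈ D}.indicator 1 p.2 := by
    rintro ⟨r, θ⟩ ⟨hr, -⟩
    have hr' : 0 < r := hr
    have hx : MeasurableEquiv.finTwoArrow.symm (polarCoord.symm (r, θ)) =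
        r • ![Real.cos θ, Real.sin θ] := by
      ext i
      fin_cases i <;> simp [MeasurableEquiv.finTwoArrow, polarCoord_symm_apply]
    rw [hx]
    by_cases hmem : ![Real.cos θ, Real.sin θ] ∈ D
    · rw [Set.indicator_of_mem ((hcone r hr' _).2 hmem), Set.indicator_of_mem (by exact hmem)]
      have : ∑ j, (r • ![Real.cos θ, Real.sin θ]) j ^ 2 = r ^ 2 := by
        simp [Fin.sum_univ_two, mul_pow, ← mul_add]
      rw [this]
      simp
    · rw [Set.indicator_of_notMem (fun h => hmem ((hcone r hr' _).1 h)),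
        Set.indicator_of_notMem (by exact hmem)]
      simp
  rw [setLIntegral_congr_fun polarCoord.open_target.measurableSet hcongr, htarget,
    Measure.volume_eq_prod, ← Measure.prod_restrict,
    lintegral_prod_mul
      (f := fun r => ENNReal.ofReal r * ENNReal.ofReal (c * Real.exp (-r ^ 2 / 2)))
      (by fun_prop) (measurable_one.indicator hΘ).aemeasurable,
    lintegral_indicator_one hΘ, Measure.restrict_apply hΘ]

/-- The intersection of two half-planes whose inner normals form the angle `φ` is a wedge with
opening angle `π - φ`. -/
lemma pi_gaussianReal_wedge {φ : ℝ} (h0 : 0 ≤ φ) (hπ : φ ≤ Real.pi) :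
    (Measure.pi fun _ : Fin 2 => gaussianReal 0 1).real
      {x | 0 < x 0 ∧ 0 < Real.cos φ * x 0 + Real.sin φ * x 1} = 1 / 2 - φ / (2 * Real.pi) := by
  obtain ⟨K, hK⟩ := exists_pi_gaussianReal_planar_cone
  have hpi := Real.pi_pos
  have h1 := hK Set.univ MeasurableSet.univ (by simp)
  have h2 := hK {x | 0 < x 0 ∧ 0 < Real.cos φ * x 0 + Real.sin φ * x 1}
    (measurableSet_pos_and_pos (by fun_prop) (by fun_prop)) (by
    intro t ht x
    have : Real.cos φ * (t * x 0) + Real.sin φ * (t * x 1) =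
      t * (Real.cos φ * x 0 + Real.sin φ * x 1) := by ring
    simp [this, ht])
  have hΘ : {θ | ![Real.cos θ, Real.sin θ] ∈
      {x : Fin 2 → ℝ | 0 < x 0 ∧ 0 < Real.cos φ * x 0 + Real.sin φ * x 1}} ∩
        Set.Ioo (-Real.pi) Real.pi = Set.Ioo (φ - Real.pi / 2) (Real.pi / 2) := by
    ext θ
    have hc : Real.cos φ * Real.cos θ + Real.sin φ * Real.sin θ = Real.cos (θ - φ) := by
      rw [Real.cos_sub]; ring
    simp only [Set.mem_inter_iff, Set.mem_ofPred_eq, Set.mem_Ioo, Matrix.cons_val_zero,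
      Matrix.cons_val_one, hc]
    constructor
    · rintro ⟨⟨hcos, hcos'⟩, hl, hr⟩
      have ha : θ < Real.pi / 2 := by
        by_contra! h
        exact absurd (Real.cos_nonpos_of_pi_div_two_le_of_le h (by linarith)) (not_le.2 hcos)
      have hb : -(Real.pi / 2) < θ := by
        by_contra! h
        have := Real.cos_nonpos_of_pi_div_two_le_of_le (x := -θ) (by linarith) (by linarith)
        rw [Real.cos_neg] at this
        linarith
      refine ⟨?_, ha⟩
      by_contra! h
      have := Real.cos_nonpos_of_pi_div_two_le_of_le (x := -(θ - φ)) (by linarith) (by linarith)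
      rw [Real.cos_neg] at this
      linarith
    · rintro ⟨hl, hr⟩
      exact ⟨⟨Real.cos_pos_of_mem_Ioo ⟨by linarith, hr⟩,
        Real.cos_pos_of_mem_Ioo ⟨by linarith, by linarith⟩⟩, by linarith, by linarith⟩
  rw [hΘ, Real.volume_Ioo] at h2
  have huniv : {θ : ℝ | ![Real.cos θ, Real.sin θ] ∈ (Set.univ : Set (Fin 2 → ℝ))} = Set.univ := by
    simp
  rw [huniv, Set.univ_inter, Real.volume_Ioo, measure_univ] at h1
  have h1' := congrArg ENNReal.toReal h1
  rw [ENNReal.toReal_one, ENNReal.toReal_mul, ENNReal.toReal_ofReal (by linarith)] at h1'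
  rw [measureReal_def, h2, ENNReal.toReal_mul, ENNReal.toReal_ofReal (by linarith)]
  have hKr : K.toReal = 1 / (2 * Real.pi) := by
    field_simp
    linarith
  rw [hKr]
  field_simp
  ring

section
variable {E : Type*} [NormedAddCommGroup E] [InnerProductSpace ℝ E] [FiniteDimensional ℝ E]
  [MeasurableSpace E] [BorelSpace E]

/-- The probability that two linear functionals of a standard Gaussian vector are both positive. It
depends only on the Gram matrix of `a` and `b`, so the computation takes place in the plane. The
vectors may be parallel. -/
lemma stdGaussian_orthant_two {a b : E} (ha : a ≠ 0) (hb : b ≠ 0) :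
    (stdGaussian E).real {x | 0 < ⟪a, x⟫ ∧ 0 < ⟪b, x⟫} =
      1 / 2 - InnerProductGeometry.angle a b / (2 * Real.pi) := by
  set φ := InnerProductGeometry.angle a b with hφ
  rw [← pi_gaussianReal_wedge (InnerProductGeometry.angle_nonneg a b)
    (InnerProductGeometry.angle_le_pi a b)]
  have hna := norm_pos_iff.2 ha
  have hnb := norm_pos_iff.2 hb
  have hm : MeasurableSet {y : EuclideanSpace ℝ (Fin 2) | 0 < y 0 ∧ 0 < y 1} :=
    measurableSet_pos_and_pos (by fun_prop) (by fun_prop)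
  let α : Fin 2 → EuclideanSpace ℝ (Fin 2) :=
    ![!₂[‖a‖, 0], !₂[‖b‖ * Real.cos φ, ‖b‖ * Real.sin φ]]
  have hgram : ∀ i j, ⟪![a, b] i, ![a, b] j⟫ = ⟪α i, α j⟫ := by
    have hab : ⟪a, b⟫ = Real.cos φ * (‖a‖ * ‖b‖) :=
      (InnerProductGeometry.cos_angle_mul_norm_mul_norm a b).symm
    have hba : ⟪b, a⟫ = Real.cos φ * (‖a‖ * ‖b‖) := by rw [real_inner_comm, hab]
    have hcs := Real.cos_sq_add_sin_sq φ
    have hinner : ∀ p q r s : ℝ, ⟪!₂[p, q], !₂[r, s]⟫ = p * r + q * s := by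
      intro p q r s
      simp [PiLp.inner_apply, Fin.sum_univ_two, mul_comm]
    intro i j
    fin_cases i <;> fin_cases j
    · refine Eq.trans ?_ (hinner ‖a‖ 0 ‖a‖ 0).symm
      rw [← sq, mul_zero, add_zero, ← real_inner_self_eq_norm_sq]
      rfl
    · refine Eq.trans hab (Eq.trans ?_ (hinner _ _ _ _).symm)
      ring
    · refine Eq.trans hba (Eq.trans ?_ (hinner _ _ _ _).symm)
      ring
    · refine Eq.trans (real_inner_self_eq_norm_sq b) (Eq.trans ?_ (hinner _ _ _ _).symm)
      linear_combination (- ‖b‖ ^ 2) * hcs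
  have hlaw := stdGaussian_map_inner_congr ![a, b] α hgram
  have e := congrArg (fun ν => ν {y : EuclideanSpace ℝ (Fin 2) | 0 < y 0 ∧ 0 < y 1}) hlaw
  simp only at e
  rw [Measure.map_apply (by fun_prop) hm, Measure.map_apply (by fun_prop) hm,
    ← map_pi_eq_stdGaussian, Measure.map_apply (by fun_prop)
      ((by fun_prop : Measurable fun x : EuclideanSpace ℝ (Fin 2) =>
        WithLp.toLp 2 fun i => ⟪α i, x⟫) hm)] at e
  rw [measureReal_def, measureReal_def]
  congr 1
  refine Eq.trans ?_ (e.trans ?_)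
  · rfl
  · congr 1
    ext x
    have h3 : x 0 * (‖b‖ * Real.cos φ) + x 1 * (‖b‖ * Real.sin φ) =
      ‖b‖ * (Real.cos φ * x 0 + Real.sin φ * x 1) := by ring
    simp only [α, PiLp.inner_apply, Fin.sum_univ_two, Set.mem_preimage, Set.mem_ofPred_eq]
    simp [hna, hnb, h3, φ]

lemma stdGaussian_real_neg (s : Set E) (hs : MeasurableSet s) :
    (stdGaussian E).real (-s) = (stdGaussian E).real s := by
  have h := stdGaussian_map (LinearIsometryEquiv.neg ℝ (E := E))
  have e : (stdGaussian E) s = ((stdGaussian E).map (LinearIsometryEquiv.neg ℝ (E := E))) s := by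
    rw [h]
  rw [Measure.map_apply (LinearIsometryEquiv.neg ℝ (E := E)).continuous.measurable hs] at e
  rw [measureReal_def, measureReal_def, e]
  rfl

lemma stdGaussian_halfSpace {a : E} (ha : a ≠ 0) :
    (stdGaussian E).real {x | 0 < ⟪a, x⟫} = 1 / 2 := by
  have h := stdGaussian_orthant_two ha ha
  rw [InnerProductGeometry.angle_self ha] at h
  simpa using h

/-- The probability that three linear functionals of a standard Gaussian vector are all positive. By
the symmetry `x ↦ -x` it equals the probability that all three are negative, that is, one minus the
probability of the union of the three positive half-spaces; inclusion-exclusion then reduces it to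
the case of two functionals. -/
lemma stdGaussian_orthant_three {a b c : E} (ha : a ≠ 0) (hb : b ≠ 0) (hc : c ≠ 0) :
    (stdGaussian E).real {x | 0 < ⟪a, x⟫ ∧ 0 < ⟪b, x⟫ ∧ 0 < ⟪c, x⟫} =
      1 / (4 * Real.pi) * (2 * Real.pi - InnerProductGeometry.angle a b -
        InnerProductGeometry.angle a c - InnerProductGeometry.angle b c) := by
  set μ := stdGaussian E
  have hms : ∀ v : E, MeasurableSet {x | 0 < ⟪v, x⟫} := fun v =>
    measurableSet_lt (by fun_prop) (by fun_prop)
  set A := {x : E | 0 < ⟪a, x⟫}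
  set B := {x : E | 0 < ⟪b, x⟫}
  set C := {x : E | 0 < ⟪c, x⟫}
  have hA : MeasurableSet A := hms a
  have hB : MeasurableSet B := hms b
  have hC : MeasurableSet C := hms c
  have pA : μ.real A = 1 / 2 := stdGaussian_halfSpace ha
  have pB : μ.real B = 1 / 2 := stdGaussian_halfSpace hb
  have pC : μ.real C = 1 / 2 := stdGaussian_halfSpace hc
  have pAB : μ.real (A ∩ B) = _ := stdGaussian_orthant_two ha hb
  have pAC : μ.real (A ∩ C) = _ := stdGaussian_orthant_two ha hc
  have pBC : μ.real (B ∩ C) = _ := stdGaussian_orthant_two hb hc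
  have hABC : {x | 0 < ⟪a, x⟫ ∧ 0 < ⟪b, x⟫ ∧ 0 < ⟪c, x⟫} = A ∩ (B ∩ C) := rfl
  rw [hABC]
  have hnull : ∀ v : E, v ≠ 0 → ∀ᵐ x ∂μ, ⟪v, x⟫ ≠ 0 := fun v hv => by
    have := stdGaussian_hyperplane hv
    rw [ae_iff]
    simpa using this
  have hneg : μ.real (A ∪ (B ∪ C))ᶜ = μ.real (A ∩ (B ∩ C)) := by
    rw [← stdGaussian_real_neg _ (hA.inter (hB.inter hC))]
    refine measureReal_congr ?_
    filter_upwards [hnull a ha, hnull b hb, hnull c hc] with x h1 h2 h3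
    have hlt : ∀ v : E, ⟪v, x⟫ ≠ 0 → (¬ 0 < ⟪v, x⟫ ↔ 0 < ⟪v, -x⟫) := by
      intro v hv
      rw [inner_neg_right, neg_pos, not_lt, le_iff_lt_or_eq]
      exact or_iff_left hv
    refine propext ?_
    change ¬ (0 < ⟪a, x⟫ ∨ 0 < ⟪b, x⟫ ∨ 0 < ⟪c, x⟫) ↔
      0 < ⟪a, -x⟫ ∧ 0 < ⟪b, -x⟫ ∧ 0 < ⟪c, -x⟫
    rw [not_or, not_or, hlt a h1, hlt b h2, hlt c h3]
  rw [measureReal_compl (hA.union (hB.union hC)), probReal_univ] at hneg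
  -- inclusion-exclusion for `A`, `B`, `C`
  have u1 := measureReal_union_add_inter (μ := μ) (s := A) (hB.union hC)
  have u2 := measureReal_union_add_inter (μ := μ) (s := B) hC
  have u3 := measureReal_union_add_inter (μ := μ) (s := A ∩ B) (hA.inter hC)
  rw [← Set.inter_union_distrib_left] at u3
  have hint : A ∩ B ∩ (A ∩ C) = A ∩ (B ∩ C) := by
    ext x; simp only [Set.mem_inter_iff]; tauto
  rw [hint] at u3
  have : μ.real (A ∩ (B ∩ C)) =
      (μ.real (A ∩ B) + μ.real (A ∩ C) + μ.real (B ∩ C) - 1 / 2) / 2 := by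
    linarith
  rw [this, pAB, pAC, pBC]
  have hpi := Real.pi_pos
  field_simp
  ring
end

/-! ### Linear independence of the chi-square laws -/

instance (k : ℕ) : IsProbabilityMeasure (chiSquareLaw k) :=
  Measure.isProbabilityMeasure_map (measurable_sum_sq k).aemeasurable

lemma chiSquareLaw_real_Iic (k : ℕ) (x : ℝ) :
    (chiSquareLaw k).real (Set.Iic x) =
      (Measure.pi fun _ : Fin k => gaussianReal 0 1).real {y | ∑ j, y j ^ 2 ≤ x} := by
  rw [measureReal_def, chiSquareLaw, Measure.map_apply (measurable_sum_sq k) measurableSet_Iic]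
  rfl

/-- A sum of `k + 1` squares is at most `x` only if the first square and the sum of the other `k`
squares both are. -/
lemma chiSquareLaw_Iic_succ_le (k : ℕ) (x : ℝ) :
    (chiSquareLaw (k + 1)).real (Set.Iic x) ≤
      (gaussianReal 0 1).real {y | y ^ 2 ≤ x} * (chiSquareLaw k).real (Set.Iic x) := by
  have hmp := measurePreserving_piFinSuccAbove (fun _ : Fin (k + 1) => gaussianReal 0 1) 0
  have h1 : MeasurableSet {y : ℝ | y ^ 2 ≤ x} := measurableSet_le (by fun_prop) (by fun_prop)
  have h2 : MeasurableSet {y : Fin k → ℝ | ∑ j, y j ^ 2 ≤ x} :=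
    measurableSet_le (by fun_prop) (by fun_prop)
  rw [chiSquareLaw_real_Iic, chiSquareLaw_real_Iic, ← measureReal_prod_prod,
    ← hmp.measureReal_preimage (h1.prod h2).nullMeasurableSet]
  refine measureReal_mono fun y hy => ?_
  have hy' : y 0 ^ 2 + ∑ j : Fin k, y j.succ ^ 2 ≤ x := by
    rw [← Fin.sum_univ_succ (f := fun j => y j ^ 2)]; exact hy
  refine Set.mem_prod.2 ⟨?_, ?_⟩
  · change y 0 ^ 2 ≤ x
    linarith [Finset.sum_nonneg fun (j : Fin k) (_ : j ∈ Finset.univ) => sq_nonneg (y j.succ)]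
  · change ∑ j : Fin k, y j.succ ^ 2 ≤ x
    linarith [sq_nonneg (y 0)]

lemma chiSquareLaw_Iic_antitone (x : ℝ) :
    Antitone fun k => (chiSquareLaw k).real (Set.Iic x) :=
  antitone_nat_of_succ_le fun k => (chiSquareLaw_Iic_succ_le k x).trans
    (mul_le_of_le_one_left measureReal_nonneg measureReal_le_one)

lemma chiSquareLaw_Iic_pos (k : ℕ) {x : ℝ} (hx : 0 < x) :
    0 < (chiSquareLaw k).real (Set.Iic x) := by
  have : (gaussianReal 0 1).IsOpenPosMeasure :=
    (gaussianReal_absolutelyContinuous' 0 one_ne_zero).isOpenPosMeasure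
  rw [chiSquareLaw_real_Iic]
  have ho : IsOpen {y : Fin k → ℝ | ∑ j, y j ^ 2 < x} := isOpen_lt (by fun_prop) (by fun_prop)
  have hp := ho.measure_pos (Measure.pi fun _ : Fin k => gaussianReal 0 1) ⟨0, by simpa using hx⟩
  rw [measureReal_def, ENNReal.toReal_pos_iff]
  refine ⟨hp.trans_le (measure_mono fun y hy => ?_), measure_lt_top _ _⟩
  exact (show ∑ j, y j ^ 2 < x from hy).le

lemma tendsto_gaussianReal_sq_le :
    Tendsto (fun x : ℝ => (gaussianReal 0 1).real {y | y ^ 2 ≤ x}) (𝓝[>] 0) (𝓝 0) := by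
  have h := tendsto_measure_biInter_gt (μ := gaussianReal 0 1)
    (s := fun x : ℝ => {y : ℝ | y ^ 2 ≤ x})
    (a := 0) (fun r _ => (measurableSet_le (by fun_prop) (by fun_prop)).nullMeasurableSet)
    (fun i j _ hij y hy => le_trans hy hij) ⟨1, one_pos, measure_ne_top _ _⟩
  have hz : (gaussianReal 0 1) (⋂ r : ℝ, ⋂ (_ : r > 0), {y : ℝ | y ^ 2 ≤ r}) = 0 := by
    have := nullSingletonClass_gaussianReal (μ := 0) (v := 1) one_ne_zero
    refine measure_mono_null (t := {0}) (fun y hy => ?_) (measure_singleton _)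
    have : y ^ 2 ≤ 0 := le_of_forall_pos_le_add fun ε hε => by
      simpa using Set.mem_iInter₂.1 hy ε hε
    simpa using le_antisymm this (sq_nonneg y)
  rw [hz] at h
  exact (ENNReal.tendsto_toReal ENNReal.zero_ne_top).comp h

/-- The distribution functions of the chi-square laws with different degrees of freedom are linearly
independent: near `0` each one is negligible compared with those of fewer degrees of freedom, so
the first nonzero coefficient would have to be `0`. -/
lemma chiSquareLaw_linearIndependent {n : ℕ} (d : Fin n → ℝ)
    (h : ∀ x : ℝ, ∑ i, d i * (chiSquareLaw i).real (Set.Iic x) = 0) : d = 0 := by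
  have key : ∀ m : ℕ, ∀ i : Fin n, (i : ℕ) = m → d i = 0 := by
    intro m
    induction m using Nat.strong_induction_on with
    | _ m ih =>
      intro i him
      by_contra hi
      have hbound : ∀ x : ℝ, 0 < x →
          |d i| ≤ (∑ j, |d j|) * (gaussianReal 0 1).real {y | y ^ 2 ≤ x} := by
        intro x hx
        have hF := chiSquareLaw_Iic_pos i hx
        set F := fun k : ℕ => (chiSquareLaw k).real (Set.Iic x) with hFdef
        set g := (gaussianReal 0 1).real {y | y ^ 2 ≤ x} with hg
        have h1 := h x
        rw [← Finset.add_sum_erase _ _ (Finset.mem_univ i)] at h1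
        have h2 : |d i| * F i ≤ ∑ j ∈ Finset.univ.erase i, |d j| * (g * F i) := by
          change |d i| * (chiSquareLaw i).real (Set.Iic x) ≤ _
          rw [← abs_of_pos hF, ← abs_mul, eq_neg_of_add_eq_zero_left h1, abs_neg]
          refine (Finset.abs_sum_le_sum_abs _ _).trans (Finset.sum_le_sum fun j hj => ?_)
          rw [abs_mul, abs_of_nonneg (measureReal_nonneg (μ := chiSquareLaw j))]
          rcases lt_or_ge (j : ℕ) m with hjm | hjm
          · rw [ih _ hjm j rfl]; simp
          · have hlt : (i : ℕ) + 1 ≤ j := by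
              have : (j : ℕ) ≠ i := fun e => (Finset.mem_erase.1 hj).1 (Fin.ext e)
              omega
            refine mul_le_mul_of_nonneg_left ?_ (abs_nonneg _)
            exact (chiSquareLaw_Iic_antitone x hlt).trans (chiSquareLaw_Iic_succ_le i x)
        have h3 : ∑ j ∈ Finset.univ.erase i, |d j| * (g * F i) ≤ (∑ j, |d j|) * g * F i := by
          rw [mul_assoc, Finset.sum_mul]
          exact Finset.sum_le_sum_of_subset_of_nonneg (Finset.erase_subset _ _) fun j _ _ =>
            mul_nonneg (abs_nonneg _) (mul_nonneg measureReal_nonneg measureReal_nonneg)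
        exact le_of_mul_le_mul_right (h2.trans h3) hF
      have hlim := tendsto_gaussianReal_sq_le.const_mul (∑ j, |d j|)
      rw [mul_zero] at hlim
      have := ge_of_tendsto hlim (eventually_nhdsWithin_of_forall fun x hx => hbound x hx)
      exact hi (abs_eq_zero.1 (le_antisymm this (abs_nonneg _)))
  ext i
  exact key i i rfl

/-! ### Projection onto a polyhedral cone -/

section
variable {E ι : Type*} [NormedAddCommGroup E] [InnerProductSpace ℝ E]

/-- The polyhedral cone cut out by the half-spaces `0 ≤ ⟪r j, x⟫`. -/
def polyCone (r : ι → E) : Set E := {x | ∀ j, 0 ≤ ⟪r j, x⟫}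

/-- The relatively open face of `polyCone r` on which exactly the constraints in `S` are strict. -/
def openFace (r : ι → E) (S : Finset ι) : Set E :=
  {x | (∀ j ∈ S, 0 < ⟪r j, x⟫) ∧ ∀ j ∉ S, ⟪r j, x⟫ = 0}

/-- The subspace on which the constraints outside `S` are tight. It is the linear span of
`openFace r S` if that face is nonempty. -/
def faceSpan (r : ι → E) (S : Finset ι) : Submodule ℝ E where
  carrier := {x | ∀ j ∉ S, ⟪r j, x⟫ = 0}
  zero_mem' := by simp
  add_mem' := by
    intro x y hx hy j hj
    rw [inner_add_right, hx j hj, hy j hj, add_zero]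
  smul_mem' := by
    intro c x hx j hj
    rw [real_inner_smul_right, hx j hj, mul_zero]

/-- The polar cone of `K`. -/
def polarCone (K : Set E) : Set E := {y | ∀ w ∈ K, ⟪y, w⟫ ≤ 0}

/-- `ξ` is the metric projection of `x` onto the convex cone `K`, expressed by Moreau's conditions:
`ξ` is in `K`, the remainder is orthogonal to `ξ`, and the remainder is in the polar cone. -/
def IsConeProj (K : Set E) (x ξ : E) : Prop :=
  ξ ∈ K ∧ ⟪x - ξ, ξ⟫ = 0 ∧ x - ξ ∈ polarCone K

lemma IsConeProj.norm_sub_sq {K : Set E} {x ξ : E} (h : IsConeProj K x ξ) :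
    ‖x‖ ^ 2 - ‖x - ξ‖ ^ 2 = ‖ξ‖ ^ 2 := by
  have h1 := norm_add_sq_real (x - ξ) ξ
  rw [h.2.1, sub_add_cancel] at h1
  linarith

lemma IsConeProj.norm_sub_add {K : Set E} {x ξ : E} (h : IsConeProj K x ξ) {w : E} (hw : w ∈ K) :
    ‖x - ξ‖ ^ 2 + ‖w - ξ‖ ^ 2 ≤ ‖x - w‖ ^ 2 := by
  have h1 := norm_sub_sq_real (x - ξ) (w - ξ)
  rw [sub_sub_sub_cancel_right, inner_sub_right, h.2.1] at h1
  linarith [h.2.2 w hw]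

lemma IsConeProj.eq {K : Set E} {x ξ w : E} (h : IsConeProj K x ξ) (hw : w ∈ K)
    (hle : ‖x - w‖ ^ 2 ≤ ‖x - ξ‖ ^ 2) : w = ξ := by
  have h1 := h.norm_sub_add hw
  have h2 : ‖w - ξ‖ ^ 2 = 0 := le_antisymm (by linarith) (sq_nonneg _)
  exact sub_eq_zero.1 (norm_eq_zero.1 (pow_eq_zero_iff two_ne_zero |>.1 h2))

lemma IsConeProj.unique {K : Set E} {x ξ w : E} (h : IsConeProj K x ξ) (hw : IsConeProj K x w) :
    w = ξ :=
  h.eq hw.1 (by linarith [hw.norm_sub_add h.1, sq_nonneg ‖ξ - w‖])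

lemma IsConeProj.isMinOn {K : Set E} {x ξ : E} (h : IsConeProj K x ξ) :
    IsMinOn (fun w => ‖x - w‖ ^ 2) K ξ := fun w hw => by
  have := h.norm_sub_add hw
  change ‖x - ξ‖ ^ 2 ≤ ‖x - w‖ ^ 2
  linarith [sq_nonneg ‖w - ξ‖]

lemma exists_isConeProj_polyCone [CompleteSpace E] (r : ι → E) (x : E) :
    ∃ ξ, IsConeProj (polyCone r) x ξ := by
  have h0 : (0 : E) ∈ polyCone r := fun j => by simp
  have hclosed : IsClosed (polyCone r) := by
    have : polyCone r = ⋂ j, {x | 0 ≤ ⟪r j, x⟫} := by ext; simp [polyCone]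
    rw [this]
    exact isClosed_iInter fun j => isClosed_le continuous_const (by fun_prop)
  have hadd : ∀ u ∈ polyCone r, ∀ v ∈ polyCone r, u + v ∈ polyCone r := fun u hu v hv j => by
    rw [inner_add_right]; exact add_nonneg (hu j) (hv j)
  have hsmul : ∀ t : ℝ, 0 ≤ t → ∀ u ∈ polyCone r, t • u ∈ polyCone r := fun t ht u hu j => by
    rw [real_inner_smul_right]; exact mul_nonneg ht (hu j)
  have hconv : Convex ℝ (polyCone r) := fun u hu v hv a b ha hb _ =>
    hadd _ (hsmul a ha u hu) _ (hsmul b hb v hv)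
  obtain ⟨ξ, hξ, hmin⟩ := exists_norm_eq_iInf_of_complete_convex ⟨0, h0⟩ hclosed.isComplete hconv x
  have h := (norm_eq_iInf_iff_real_inner_le_zero hconv hξ).1 hmin
  have h1 := h 0 h0
  have h2 := h (ξ + ξ) (hadd ξ hξ ξ hξ)
  rw [add_sub_cancel_right] at h2
  rw [zero_sub, inner_neg_right] at h1
  have horth : ⟪x - ξ, ξ⟫ = 0 := le_antisymm h2 (by linarith)
  refine ⟨ξ, hξ, horth, fun w hw => ?_⟩
  have h3 := h w hw
  rwa [inner_sub_right, horth, sub_zero] at h3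

/-- The points whose projection onto `polyCone r` lies in the relatively open face of `S`. -/
def faceRegion (r : ι → E) (S : Finset ι) : Set E :=
  {x | ∃ ξ ∈ openFace r S, IsConeProj (polyCone r) x ξ}

lemma openFace_subset_polyCone (r : ι → E) (S : Finset ι) : openFace r S ⊆ polyCone r := by
  intro x hx j
  by_cases hj : j ∈ S
  · exact (hx.1 j hj).le
  · exact (hx.2 j hj).ge

lemma openFace_disjoint {r : ι → E} {S T : Finset ι} {x : E} (hS : x ∈ openFace r S)
    (hT : x ∈ openFace r T) : S = T := by
  have : ∀ {U V : Finset ι}, x ∈ openFace r U → x ∈ openFace r V → U ⊆ V := by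
    intro U V hU hV j hj
    by_contra hjV
    exact (hU.1 j hj).ne' (hV.2 j hjV)
  exact Finset.Subset.antisymm (this hS hT) (this hT hS)

lemma exists_mem_openFace [Fintype ι] {r : ι → E} {x : E} (hx : x ∈ polyCone r) :
    x ∈ openFace r (Finset.univ.filter fun j => 0 < ⟪r j, x⟫) := by
  refine ⟨fun j hj => (Finset.mem_filter.1 hj).2, fun j hj => ?_⟩
  simp only [Finset.mem_filter, Finset.mem_univ, true_and, not_lt] at hj
  exact le_antisymm hj (hx j)

lemma eq_filter_of_mem_openFace [Fintype ι] {r : ι → E} {S : Finset ι} {x : E}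
    (hx : x ∈ openFace r S) : S = Finset.univ.filter fun j => 0 < ⟪r j, x⟫ :=
  openFace_disjoint hx (exists_mem_openFace (openFace_subset_polyCone r S hx))

lemma smul_mem_openFace {r : ι → E} {S : Finset ι} {t : ℝ} (ht : 0 < t) (x : E) :
    t • x ∈ openFace r S ↔ x ∈ openFace r S := by
  simp [openFace, real_inner_smul_right, ht, ht.ne']

/-- If the projection onto the cone lies in the relatively open face of `S`, it is the orthogonal
projection onto the span of that face. -/
lemma IsConeProj.eq_starProjection [Finite ι] [FiniteDimensional ℝ E] {r : ι → E} {S : Finset ι}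
    {x ξ : E} (h : IsConeProj (polyCone r) x ξ) (hξ : ξ ∈ openFace r S) :
    (faceSpan r S).starProjection x = ξ := by
  have := Fintype.ofFinite ι
  refine Submodule.eq_starProjection_of_mem_of_inner_eq_zero (fun j hj => hξ.2 j hj) fun v hv => ?_
  -- moving from `ξ` by a small multiple of `v` stays inside the cone
  have hev : ∀ u ∈ faceSpan r S, ⟪x - ξ, u⟫ ≤ 0 := by
    intro u hu
    have hsmall : ∀ᶠ ε in nhdsWithin (0 : ℝ) (Set.Ioi 0), ∀ j, 0 ≤ ⟪r j, ξ + ε • u⟫ := by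
      rw [Filter.eventually_all]
      intro j
      by_cases hj : j ∈ S
      · have hc : Continuous fun ε : ℝ => ⟪r j, ξ + ε • u⟫ := by fun_prop
        have := hc.tendsto 0
        rw [zero_smul, add_zero] at this
        exact ((this.eventually (lt_mem_nhds (hξ.1 j hj))).filter_mono nhdsWithin_le_nhds).mono
          fun ε hε => hε.le
      · refine Filter.Eventually.of_forall fun ε => ?_
        rw [inner_add_right, real_inner_smul_right, hξ.2 j hj, hu j hj, mul_zero, add_zero]
    obtain ⟨ε, hε, hε0⟩ := (hsmall.and self_mem_nhdsWithin).exists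
    have h1 := h.2.2 _ hε
    rw [inner_add_right, h.2.1, zero_add, real_inner_smul_right] at h1
    exact nonpos_of_mul_nonpos_right h1 hε0
  have h1 := hev v hv
  have h2 := hev (-v) (neg_mem hv)
  rw [inner_neg_right] at h2
  linarith

/-- The region of a face is a product: a condition on the component in the span of the face, and a
condition on the component orthogonal to it. -/
lemma faceRegion_eq [Finite ι] [FiniteDimensional ℝ E] (r : ι → E) (S : Finset ι) :
    faceRegion r S = {x | (faceSpan r S).starProjection x ∈ openFace r S ∧
      x - (faceSpan r S).starProjection x ∈ polarCone (polyCone r)} := by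
  ext x
  constructor
  · rintro ⟨ξ, hξ, h⟩
    change _ ∈ _ ∧ _ ∈ _
    rw [h.eq_starProjection hξ]
    exact ⟨hξ, h.2.2⟩
  · rintro ⟨h1, h2⟩
    exact ⟨_, h1, openFace_subset_polyCone r S h1,
      Submodule.starProjection_inner_eq_zero _ _ (Submodule.starProjection_apply_mem _ _), h2⟩

lemma finrank_faceSpan [Fintype ι] {r : ι → E}
    (hr : Function.Bijective fun (x : E) (j : ι) => ⟪r j, x⟫) (S : Finset ι) :
    Module.finrank ℝ (faceSpan r S) = S.card := by
  let f : faceSpan r S →ₗ[ℝ] (S → ℝ) :=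
    { toFun := fun x j => ⟪r j, (x : E)⟫
      map_add' := fun x y => by ext j; simp [inner_add_right]
      map_smul' := fun c x => by ext j; simp [real_inner_smul_right] }
  have hf : Function.Bijective f := by
    constructor
    · intro x y hxy
      refine Subtype.ext (hr.1 (funext fun j => ?_))
      by_cases hj : j ∈ S
      · exact congrFun hxy ⟨j, hj⟩
      · exact (x.2 j hj).trans (y.2 j hj).symm
    · intro v
      classical
      obtain ⟨x, hx⟩ := hr.2 fun j => if hj : j ∈ S then v ⟨j, hj⟩ else 0
      have hx' : ∀ j, ⟪r j, x⟫ = if hj : j ∈ S then v ⟨j, hj⟩ else 0 := congrFun hx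
      refine ⟨⟨x, fun j hj => by rw [hx', dif_neg hj]⟩, funext fun j => ?_⟩
      exact (hx' j).trans (by simp)
  rw [(LinearEquiv.ofBijective f hf).finrank_eq, Module.finrank_fintype_fun_eq_card,
    Fintype.card_coe]

/-- The Karush-Kuhn-Tucker description of the region of a face, with multipliers `-c j ≥ 0` for the
tight constraints. -/
lemma mem_faceRegion_iff [Fintype ι] [FiniteDimensional ℝ E] {r : ι → E}
    (hr : Function.Bijective fun (x : E) (j : ι) => ⟪r j, x⟫) {S : Finset ι} {x : E} :
    x ∈ faceRegion r S ↔
      ∃ c : ι → ℝ, (∀ j, c j ≤ 0) ∧ (∀ j ∈ S, c j = 0) ∧ x - ∑ j, c j • r j ∈ openFace r S := by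
  classical
  constructor
  · rintro ⟨ξ, hξ, h⟩
    have hP := h.eq_starProjection hξ
    -- the basis dual to `r`; each of its members lies in the cone
    choose w hw using fun k : ι => hr.2 (Pi.single k 1)
    have hw' : ∀ k j, ⟪r j, w k⟫ = if j = k then 1 else 0 := fun k j => by
      have := congrFun (hw k) j
      rwa [Pi.single_apply] at this
    refine ⟨fun k => ⟪x - ξ, w k⟫, fun k => h.2.2 _ fun j => ?_, fun k hk => ?_, ?_⟩
    · rw [hw']; split_ifs <;> norm_num
    · rw [← hP]
      refine Submodule.starProjection_inner_eq_zero _ _ fun j hj => ?_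
      rw [hw', if_neg]
      rintro rfl
      exact hj hk
    · have hsum : ∑ k, ⟪x - ξ, w k⟫ • r k = x - ξ := by
        refine ext_inner_right ℝ fun v => ?_
        have hv : v = ∑ k, ⟪r k, v⟫ • w k := by
          refine hr.1 (funext fun j => ?_)
          simp [inner_sum, real_inner_smul_right, hw']
        conv_rhs => rw [hv]
        simp only [sum_inner, inner_sum, real_inner_smul_left, real_inner_smul_right]
        exact Finset.sum_congr rfl fun k _ => mul_comm _ _
      rw [hsum, sub_sub_cancel]
      exact hξ
  · rintro ⟨c, hc, hcS, hmem⟩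
    refine ⟨_, hmem, openFace_subset_polyCone r S hmem, ?_, fun w hw => ?_⟩
    · rw [sub_sub_cancel, sum_inner]
      refine Finset.sum_eq_zero fun j _ => ?_
      rw [real_inner_smul_left]
      by_cases hj : j ∈ S
      · rw [hcS j hj, zero_mul]
      · rw [hmem.2 j hj, mul_zero]
    · rw [sub_sub_cancel, sum_inner]
      refine Finset.sum_nonpos fun j _ => ?_
      rw [real_inner_smul_left]
      exact mul_nonpos_of_nonpos_of_nonneg (hc j) (hw j)

lemma measurableSet_polarCone [MeasurableSpace E] [BorelSpace E] (K : Set E) :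
    MeasurableSet (polarCone K) := by
  have : polarCone K = ⋂ w ∈ K, {y | ⟪y, w⟫ ≤ 0} := by ext; simp [polarCone]
  rw [this]
  exact (isClosed_biInter fun w _ => isClosed_le (by fun_prop) continuous_const).measurableSet

lemma pairwise_disjoint_faceRegion (r : ι → E) :
    Pairwise (Function.onFun Disjoint (faceRegion r)) := by
  intro S T hST
  refine Set.disjoint_left.2 ?_
  rintro x ⟨ξ, hξ, h⟩ ⟨ζ, hζ, h'⟩
  rw [h.unique h'] at hζ
  exact hST (openFace_disjoint hξ hζ)

lemma mem_faceRegion_of_isConeProj [Fintype ι] {r : ι → E} {x ξ : E} 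
    (h : IsConeProj (polyCone r) x ξ) :
    x ∈ faceRegion r (Finset.univ.filter fun j => 0 < ⟪r j, ξ⟫) :=
  ⟨ξ, exists_mem_openFace h.1, h⟩

end

section
variable {E ι : Type*} [NormedAddCommGroup E] [InnerProductSpace ℝ E] [FiniteDimensional ℝ E]
  [MeasurableSpace E] [BorelSpace E] [Fintype ι]

lemma measurableSet_openFace (r : ι → E) (S : Finset ι) : MeasurableSet (openFace r S) := by
  have : openFace r S =
      (⋂ j ∈ S, {x | 0 < ⟪r j, x⟫}) ∩ ⋂ j ∈ (Sᶜ : Set ι), {x | ⟪r j, x⟫ = 0} := by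
    ext x; simp [openFace]
  rw [this]
  exact (Finset.measurableSet_biInter _ fun j _ =>
    measurableSet_lt (by fun_prop) (by fun_prop)).inter
    (MeasurableSet.biInter (Set.to_countable _) fun j _ =>
      measurableSet_eq_fun (by fun_prop) (by fun_prop))

lemma measurableSet_faceRegion (r : ι → E) (S : Finset ι) : MeasurableSet (faceRegion r S) := by
  have hP : Measurable fun x => (faceSpan r S).starProjection x := by fun_prop
  rw [faceRegion_eq]
  exact (hP (measurableSet_openFace r S)).inter
    ((measurable_id.sub hP) (measurableSet_polarCone (polyCone r)))

/-- Given that the projection of a standard Gaussian vector onto the cone lies in the face of `S`,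
its squared length is chi-square with `S.card` degrees of freedom. -/
lemma stdGaussian_faceRegion_inter {r : ι → E}
    (hr : Function.Bijective fun (x : E) (j : ι) => ⟪r j, x⟫) (S : Finset ι) (t : ℝ) :
    (stdGaussian E).real {x | ∃ ξ ∈ openFace r S, IsConeProj (polyCone r) x ξ ∧ ‖ξ‖ ^ 2 ≤ t} =
      (stdGaussian E).real (faceRegion r S) * (chiSquareLaw S.card).real (Set.Iic t) := by
  have h := stdGaussian_projection_cone_inter_ball (faceSpan r S) (measurableSet_openFace r S)
    (measurableSet_polarCone (polyCone r)) (fun s hs x => smul_mem_openFace hs x) t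
  have e : {x | ∃ ξ ∈ openFace r S, IsConeProj (polyCone r) x ξ ∧ ‖ξ‖ ^ 2 ≤ t} =
      {x | ((faceSpan r S).starProjection x ∈ openFace r S ∧
        x - (faceSpan r S).starProjection x ∈ polarCone (polyCone r)) ∧
        ‖(faceSpan r S).starProjection x‖ ^ 2 ≤ t} := by
    ext x
    constructor
    · rintro ⟨ξ, hξ, h, hle⟩
      have hx : x ∈ faceRegion r S := ⟨ξ, hξ, h⟩
      rw [faceRegion_eq] at hx
      refine ⟨hx, ?_⟩
      rwa [h.eq_starProjection hξ]
    · rintro ⟨hx, hle⟩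
      have hx' : x ∈ faceRegion r S := by rw [faceRegion_eq]; exact hx
      obtain ⟨ξ, hξ, h⟩ := hx'
      rw [h.eq_starProjection hξ] at hle
      exact ⟨ξ, hξ, h, hle⟩
  rw [← faceRegion_eq, ← e, finrank_faceSpan hr] at h
  rw [measureReal_def, h, ENNReal.toReal_mul]
  rfl

/-- The squared length of the projection of a standard Gaussian vector onto a simplicial cone is a
mixture of chi-square laws. -/
lemma stdGaussian_norm_coneProj_le {r : ι → E}
    (hr : Function.Bijective fun (x : E) (j : ι) => ⟪r j, x⟫) (t : ℝ) :
    (stdGaussian E).real {x | ∃ ξ, IsConeProj (polyCone r) x ξ ∧ ‖ξ‖ ^ 2 ≤ t} =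
      ∑ S : Finset ι,
        (stdGaussian E).real (faceRegion r S) * (chiSquareLaw S.card).real (Set.Iic t) := by
  simp_rw [← stdGaussian_faceRegion_inter hr]
  rw [← measureReal_biUnion_finset]
  · congr 1
    ext x
    simp only [Set.mem_ofPred_eq, Set.mem_iUnion, Finset.mem_univ, exists_true_left]
    constructor
    · rintro ⟨ξ, h, hle⟩
      exact ⟨_, ξ, exists_mem_openFace h.1, h, hle⟩
    · rintro ⟨S, ξ, -, h, hle⟩
      exact ⟨ξ, h, hle⟩
  · intro S _ T _ hST
    refine (pairwise_disjoint_faceRegion r hST).mono ?_ ?_ <;>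
    · rintro x ⟨ξ, hξ, h, -⟩
      exact ⟨ξ, hξ, h⟩
  · intro S _
    have : {x | ∃ ξ ∈ openFace r S, IsConeProj (polyCone r) x ξ ∧ ‖ξ‖ ^ 2 ≤ t} =
        faceRegion r S ∩ {x | ‖(faceSpan r S).starProjection x‖ ^ 2 ≤ t} := by
      ext x
      constructor
      · rintro ⟨ξ, hξ, h, hle⟩
        refine ⟨⟨ξ, hξ, h⟩, ?_⟩
        change ‖_‖ ^ 2 ≤ t
        rwa [h.eq_starProjection hξ]
      · rintro ⟨⟨ξ, hξ, h⟩, hle⟩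
        change ‖_‖ ^ 2 ≤ t at hle
        rw [h.eq_starProjection hξ] at hle
        exact ⟨ξ, hξ, h, hle⟩
    rw [this]
    exact (measurableSet_faceRegion r S).inter (measurableSet_le (by fun_prop) (by fun_prop))

lemma stdGaussian_coneProj_card (r : ι → E) (i : ℕ) :
    (stdGaussian E).real {x | ∃ ξ, IsConeProj (polyCone r) x ξ ∧
        (Finset.univ.filter fun j => 0 < ⟪r j, ξ⟫).card = i} =
      ∑ S : Finset ι with S.card = i, (stdGaussian E).real (faceRegion r S) := by
  rw [← measureReal_biUnion_finset]
  · congr 1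
    ext x
    simp only [Set.mem_ofPred_eq, Set.mem_iUnion, Finset.mem_filter, Finset.mem_univ, true_and]
    constructor
    · rintro ⟨ξ, h, hi⟩
      exact ⟨_, hi, mem_faceRegion_of_isConeProj h⟩
    · rintro ⟨S, hS, ξ, hξ, h⟩
      refine ⟨ξ, h, ?_⟩
      rw [← eq_filter_of_mem_openFace hξ, hS]
  · intro S _ T _ hST
    exact pairwise_disjoint_faceRegion r hST
  · exact fun S _ => measurableSet_faceRegion r S

lemma sum_stdGaussian_faceRegion (r : ι → E) :
    ∑ S : Finset ι, (stdGaussian E).real (faceRegion r S) = 1 := by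
  rw [← measureReal_biUnion_finset]
  · convert probReal_univ (μ := stdGaussian E)
    refine Set.eq_univ_of_forall fun x => ?_
    obtain ⟨ξ, h⟩ := exists_isConeProj_polyCone r x
    exact Set.mem_biUnion (Finset.mem_univ _) (mem_faceRegion_of_isConeProj h)
  · intro S _ T _ hST
    exact pairwise_disjoint_faceRegion r hST
  · exact fun S _ => measurableSet_faceRegion r S
end

/-! ### The regions of faces of high and low dimension -/

section
variable {E ι : Type*} [NormedAddCommGroup E] [InnerProductSpace ℝ E]
  {r : ι → E}

lemma ne_zero_of_bijective_inner
    (hr : Function.Bijective fun (x : E) (j : ι) => ⟪r j, x⟫) (j : ι) :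
    r j ≠ 0 := by
  obtain ⟨w, hw⟩ := hr.2 fun _ => 1
  intro h0
  have : ⟪r j, w⟫ = 1 := congrFun hw j
  rw [h0, inner_zero_left] at this
  exact zero_ne_one this

lemma exists_inner_eq_single (hr : Function.Bijective fun (x : E) (j : ι) => ⟪r j, x⟫) (k : ι) :
    ∃ w, ⟪r k, w⟫ = 1 ∧ ∀ j, j ≠ k → ⟪r j, w⟫ = 0 := by
  classical
  obtain ⟨w, hw⟩ := hr.2 (Pi.single k 1)
  refine ⟨w, (congrFun hw k).trans (Pi.single_eq_same _ _), fun j hj => ?_⟩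
  exact (congrFun hw j).trans (Pi.single_eq_of_ne hj _)

lemma mem_faceRegion_univ [FiniteDimensional ℝ E] [Fintype ι]
    (hr : Function.Bijective fun (x : E) (j : ι) => ⟪r j, x⟫) {x : E} :
    x ∈ faceRegion r Finset.univ ↔ ∀ j, 0 < ⟪r j, x⟫ := by
  rw [mem_faceRegion_iff hr]
  constructor
  · rintro ⟨c, -, hc, hmem⟩ j
    have : ∑ j, c j • r j = 0 := Finset.sum_eq_zero fun j hj => by rw [hc j hj, zero_smul]
    rw [this, sub_zero] at hmem
    exact hmem.1 j (Finset.mem_univ j)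
  · intro h
    refine ⟨0, fun _ => le_rfl, fun _ _ => rfl, ?_⟩
    simpa [openFace] using h

/-- The component of `r j` orthogonal to `r k`. -/
noncomputable def residualVec (r : ι → E) (k j : ι) : E := r j - (⟪r j, r k⟫ / ⟪r k, r k⟫) • r k

lemma residualVec_ne_zero (hr : Function.Bijective fun (x : E) (j : ι) => ⟪r j, x⟫) {k j : ι}
    (hjk : j ≠ k) : residualVec r k j ≠ 0 := by
  obtain ⟨w, hw, hw'⟩ := exists_inner_eq_single hr j
  intro h0
  have h1 : ⟪residualVec r k j, w⟫ = 1 := by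
    rw [residualVec, inner_sub_left, real_inner_smul_left, hw, hw' k hjk.symm]; ring
  rw [h0, inner_zero_left] at h1
  exact zero_ne_one h1

lemma inner_residualVec (k j : ι) (hk : r k ≠ 0) : ⟪r k, residualVec r k j⟫ = 0 := by
  have : ⟪r k, r k⟫ ≠ 0 := inner_self_ne_zero.2 hk
  rw [residualVec, inner_sub_right, real_inner_smul_right, div_mul_cancel₀ _ this, real_inner_comm,
    sub_self]

/-- The region of the facet on which only the constraint `k` is tight. -/
lemma mem_faceRegion_erase [FiniteDimensional ℝ E] [Fintype ι] [DecidableEq ι]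
    (hr : Function.Bijective fun (x : E) (j : ι) => ⟪r j, x⟫) (k : ι)
    {x : E} : x ∈ faceRegion r (Finset.univ.erase k) ↔
      ⟪r k, x⟫ ≤ 0 ∧ ∀ j, j ≠ k → 0 < ⟪residualVec r k j, x⟫ := by
  have hpos : 0 < ⟪r k, r k⟫ := real_inner_self_pos.2 (ne_zero_of_bijective_inner hr k)
  rw [mem_faceRegion_iff hr]
  simp only [Finset.mem_erase, Finset.mem_univ, and_true, openFace, Set.mem_ofPred_eq, not_not,
    forall_eq, residualVec, inner_sub_left, real_inner_smul_left]
  constructor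
  · rintro ⟨c, hc, hc0, hS, hk⟩
    have hsum : ∑ j, c j • r j = c k • r k :=
      Finset.sum_eq_single k (fun j _ hj => by rw [hc0 j hj, zero_smul]) (by simp)
    rw [hsum] at hS hk
    simp only [inner_sub_right, real_inner_smul_right] at hS hk
    have hx : ⟪r k, x⟫ = c k * ⟪r k, r k⟫ := by linarith
    refine ⟨by rw [hx]; exact mul_nonpos_of_nonpos_of_nonneg (hc k) hpos.le, fun j hj => ?_⟩
    have h1 : ⟪r j, r k⟫ / ⟪r k, r k⟫ * ⟪r k, x⟫ = c k * ⟪r j, r k⟫ := by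
      rw [hx]; field_simp
    rw [h1]
    exact hS j hj
  · rintro ⟨hx, hj⟩
    refine ⟨Pi.single k (⟪r k, x⟫ / ⟪r k, r k⟫), fun j => ?_,
      fun j hjk => Pi.single_eq_of_ne hjk _, ?_⟩
    · rcases eq_or_ne j k with rfl | h
      · rw [Pi.single_eq_same]; exact div_nonpos_of_nonpos_of_nonneg hx hpos.le
      · rw [Pi.single_eq_of_ne h]
    · have hsum : ∑ j, (Pi.single k (⟪r k, x⟫ / ⟪r k, r k⟫) : ι → ℝ) j • r j =
          (⟪r k, x⟫ / ⟪r k, r k⟫) • r k := by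
        rw [Finset.sum_eq_single k (fun j _ hj => by rw [Pi.single_eq_of_ne hj, zero_smul])
          (by simp), Pi.single_eq_same]
      rw [hsum]
      simp only [inner_sub_right, real_inner_smul_right]
      refine ⟨fun j hjk => ?_, ?_⟩
      · have := hj j hjk
        have e : ⟪r j, r k⟫ / ⟪r k, r k⟫ * ⟪r k, x⟫ = ⟪r k, x⟫ / ⟪r k, r k⟫ * ⟪r j, r k⟫ := by ring
        rwa [← e]
      · field_simp; ring

/-- The vector in the span of `r k` and `r l` that is orthogonal to `r l`, scaled by the cofactors
of the Gram matrix: `⟪cofactorVec r k l, x⟫` is the multiplier of `r k` in the projection of `x` onto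
that span, times the Gram determinant. -/
def cofactorVec (r : ι → E) (k l : ι) : E := ⟪r l, r l⟫ • r k - ⟪r k, r l⟫ • r l

lemma inner_cofactorVec_left (k l : ι) :
    ⟪cofactorVec r k l, r k⟫ = ⟪r k, r k⟫ * ⟪r l, r l⟫ - ⟪r k, r l⟫ ^ 2 := by
  rw [cofactorVec, inner_sub_left, real_inner_smul_left, real_inner_smul_left,
    real_inner_comm (r k) (r l)]
  ring

lemma inner_cofactorVec_right (k l : ι) : ⟪cofactorVec r k l, r l⟫ = 0 := by
  rw [cofactorVec, inner_sub_left, real_inner_smul_left, real_inner_smul_left]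
  ring

lemma cofactorVec_ne_zero (hr : Function.Bijective fun (x : E) (j : ι) => ⟪r j, x⟫) {k l : ι}
    (hkl : k ≠ l) : cofactorVec r k l ≠ 0 := by
  obtain ⟨w, hw, hw'⟩ := exists_inner_eq_single hr k
  intro h0
  have h1 : ⟪cofactorVec r k l, w⟫ = ⟪r l, r l⟫ := by
    rw [cofactorVec, inner_sub_left, real_inner_smul_left, real_inner_smul_left, hw,
      hw' l hkl.symm]; ring
  rw [h0, inner_zero_left] at h1
  exact ne_zero_of_bijective_inner hr l (inner_self_eq_zero.1 h1.symm)

lemma inner_cofactorVec_self (k l : ι) : ⟪cofactorVec r k l, cofactorVec r k l⟫ =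
    ⟪r l, r l⟫ * (⟪r k, r k⟫ * ⟪r l, r l⟫ - ⟪r k, r l⟫ ^ 2) := by
  nth_rewrite 2 [cofactorVec]
  rw [inner_sub_right, real_inner_smul_right, real_inner_smul_right, inner_cofactorVec_left,
    inner_cofactorVec_right]
  ring

lemma inner_cofactorVec_swap (k l : ι) : ⟪cofactorVec r k l, cofactorVec r l k⟫ =
    -⟪r k, r l⟫ * (⟪r k, r k⟫ * ⟪r l, r l⟫ - ⟪r k, r l⟫ ^ 2) := by
  rw [cofactorVec.eq_1 r l k, inner_sub_right, real_inner_smul_right, real_inner_smul_right,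
    inner_cofactorVec_left, inner_cofactorVec_right, real_inner_comm (r k) (r l)]
  ring

lemma gram_two_pos (hr : Function.Bijective fun (x : E) (j : ι) => ⟪r j, x⟫) {k l : ι}
    (hkl : k ≠ l) : 0 < ⟪r k, r k⟫ * ⟪r l, r l⟫ - ⟪r k, r l⟫ ^ 2 := by
  have h1 := real_inner_self_pos.2 (cofactorVec_ne_zero hr hkl)
  rw [inner_cofactorVec_self] at h1
  exact pos_of_mul_pos_right h1
    (real_inner_self_pos.2 (ne_zero_of_bijective_inner hr l)).le

/-- The cofactor vectors point along the dual basis of the plane spanned by `r k` and `r l`, so they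
form the supplementary angle. -/
lemma angle_cofactorVec (hr : Function.Bijective fun (x : E) (j : ι) => ⟪r j, x⟫) {k l : ι}
    (hkl : k ≠ l) :
    angle (cofactorVec r k l) (cofactorVec r l k) = Real.pi - angle (r k) (r l) := by
  have hD := gram_two_pos hr hkl
  have hk := norm_pos_iff.2 (ne_zero_of_bijective_inner hr k)
  have hl := norm_pos_iff.2 (ne_zero_of_bijective_inner hr l)
  rw [angle, angle, ← Real.arccos_neg, inner_cofactorVec_swap]
  set D := ⟪r k, r k⟫ * ⟪r l, r l⟫ - ⟪r k, r l⟫ ^ 2 with hDdef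
  have hD' : ⟪r l, r l⟫ * ⟪r k, r k⟫ - ⟪r l, r k⟫ ^ 2 = D := by
    rw [real_inner_comm (r k) (r l)]; ring
  have n1 : ‖cofactorVec r k l‖ = ‖r l‖ * √D := by
    rw [norm_eq_sqrt_real_inner, inner_cofactorVec_self, ← hDdef, real_inner_self_eq_norm_sq (r l),
      Real.sqrt_mul (sq_nonneg _), Real.sqrt_sq hl.le]
  have n2 : ‖cofactorVec r l k‖ = ‖r k‖ * √D := by
    rw [norm_eq_sqrt_real_inner, inner_cofactorVec_self, hD', real_inner_self_eq_norm_sq (r k),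
      Real.sqrt_mul (sq_nonneg _), Real.sqrt_sq hk.le]
  have hsD := Real.sqrt_pos.2 hD
  have e : ‖r l‖ * √D * (‖r k‖ * √D) = ‖r k‖ * ‖r l‖ * D := by
    nth_rewrite 3 [← Real.sq_sqrt hD.le]
    ring
  rw [n1, n2, e]
  congr 1
  field_simp

/-- The region of the ray on which two of three constraints are tight: the two multipliers are
nonpositive and the third constraint is positive at the projection. All quantities are multiplied
by the Gram determinant of `r k` and `r l`. -/
lemma mem_faceRegion_singleton [FiniteDimensional ℝ E] [Fintype ι] [DecidableEq ι]
    (hr : Function.Bijective fun (x : E) (j : ι) => ⟪r j, x⟫)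
    {j k l : ι} (hkl : k ≠ l) (hjk : j ≠ k) (hjl : j ≠ l) (hall : ∀ m, m = j ∨ m = k ∨ m = l)
    {x : E} : x ∈ faceRegion r {j} ↔
      ⟪cofactorVec r k l, x⟫ ≤ 0 ∧ ⟪cofactorVec r l k, x⟫ ≤ 0 ∧
        0 < ⟪(⟪r k, r k⟫ * ⟪r l, r l⟫ - ⟪r k, r l⟫ ^ 2) • r j -
          (⟪r j, r k⟫ • cofactorVec r k l + ⟪r j, r l⟫ • cofactorVec r l k), x⟫ := by
  have hD := gram_two_pos hr hkl
  have huniv : (Finset.univ : Finset ι) = {j, k, l} := by ext m; simp [hall m]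
  have hsum : ∀ c : ι → ℝ, c j = 0 → ∑ m, c m • r m = c k • r k + c l • r l := by
    intro c hc
    rw [huniv, Finset.sum_insert (by simp [hjk, hjl]), Finset.sum_pair hkl, hc, zero_smul, zero_add]
  have hall' : ∀ p : ι → Prop, (∀ m, m ≠ j → p m) ↔ p k ∧ p l := by
    intro p
    refine ⟨fun h => ⟨h k hjk.symm, h l hjl.symm⟩, fun h m hm => ?_⟩
    rcases hall m with rfl | rfl | rfl
    exacts [absurd rfl hm, h.1, h.2]
  rw [mem_faceRegion_iff hr]
  simp only [Finset.mem_singleton, openFace, Set.mem_ofPred_eq, forall_eq, hall']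
  set D := ⟪r k, r k⟫ * ⟪r l, r l⟫ - ⟪r k, r l⟫ ^ 2 with hDdef
  have ck : ⟪cofactorVec r k l, x⟫ = ⟪r l, r l⟫ * ⟪r k, x⟫ - ⟪r k, r l⟫ * ⟪r l, x⟫ := by
    rw [cofactorVec, inner_sub_left, real_inner_smul_left, real_inner_smul_left]
  have cl : ⟪cofactorVec r l k, x⟫ = ⟪r k, r k⟫ * ⟪r l, x⟫ - ⟪r k, r l⟫ * ⟪r k, x⟫ := by
    rw [cofactorVec, inner_sub_left, real_inner_smul_left, real_inner_smul_left,
      real_inner_comm (r k) (r l)]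
  simp only [inner_sub_left, inner_add_left, real_inner_smul_left]
  constructor
  · rintro ⟨c, hc, hcj, hpos, h1, h2⟩
    rw [hsum c hcj] at hpos h1 h2
    simp only [inner_sub_right, inner_add_right, real_inner_smul_right,
      real_inner_comm (r k) (r l)] at hpos h1 h2
    have e1 : ⟪cofactorVec r k l, x⟫ = c k * D := by
      rw [ck, hDdef]; linear_combination ⟪r l, r l⟫ * h1 - ⟪r k, r l⟫ * h2
    have e2 : ⟪cofactorVec r l k, x⟫ = c l * D := by
      rw [cl, hDdef]; linear_combination ⟪r k, r k⟫ * h2 - ⟪r k, r l⟫ * h1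
    rw [e1, e2]
    refine ⟨mul_nonpos_of_nonpos_of_nonneg (hc k) hD.le,
      mul_nonpos_of_nonpos_of_nonneg (hc l) hD.le, ?_⟩
    have := mul_pos hD hpos
    linarith
  · rintro ⟨h1, h2, h3⟩
    set u := ⟪cofactorVec r k l, x⟫ with hu
    set v := ⟪cofactorVec r l k, x⟫ with hv
    -- the multipliers, by Cramer's rule
    let c : ι → ℝ := fun m => if m = k then u / D else if m = l then v / D else 0
    have hcj : c j = 0 := by simp [c, hjk, hjl]
    have hck : c k = u / D := by simp [c]
    have hcl : c l = v / D := by simp [c, hkl.symm]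
    refine ⟨c, fun m => ?_, hcj, ?_⟩
    · rcases hall m with rfl | rfl | rfl
      · exact hcj.le
      · rw [hck]; exact div_nonpos_of_nonpos_of_nonneg h1 hD.le
      · rw [hcl]; exact div_nonpos_of_nonpos_of_nonneg h2 hD.le
    · rw [hsum c hcj, hck, hcl]
      simp only [inner_sub_right, inner_add_right, real_inner_smul_right,
        real_inner_comm (r k) (r l)]
      refine ⟨?_, ?_, ?_⟩
      · have : ⟪r j, x⟫ - (u / D * ⟪r j, r k⟫ + v / D * ⟪r j, r l⟫) =
            (D * ⟪r j, x⟫ - (⟪r j, r k⟫ * u + ⟪r j, r l⟫ * v)) / D := by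
          field_simp
        rw [this]
        exact div_pos h3 hD
      · field_simp
        rw [ck, cl, hDdef]
        ring
      · field_simp
        rw [ck, cl, hDdef]
        ring
end

/-! ### Probabilities of the regions in dimension at most three -/

section
variable {E ι : Type*} [NormedAddCommGroup E] [InnerProductSpace ℝ E] [FiniteDimensional ℝ E]
  [MeasurableSpace E] [BorelSpace E] [Fintype ι] {r : ι → E}

omit [Fintype ι] in
lemma ae_inner_nonpos_iff {a : E} (ha : a ≠ 0) :
    ∀ᵐ x ∂(stdGaussian E), ⟪a, x⟫ ≤ 0 ↔ 0 < ⟪-a, x⟫ := by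
  have h : ∀ᵐ x ∂(stdGaussian E), ⟪a, x⟫ ≠ 0 := by
    rw [ae_iff]
    simpa using stdGaussian_hyperplane ha
  filter_upwards [h] with x hx
  rw [inner_neg_left, neg_pos, le_iff_lt_or_eq]
  exact or_iff_left hx

lemma stdGaussian_faceRegion_univ_one [Unique ι]
    (hr : Function.Bijective fun (x : E) (j : ι) => ⟪r j, x⟫) :
    (stdGaussian E).real (faceRegion r Finset.univ) = 1 / 2 := by
  rw [← stdGaussian_halfSpace (ne_zero_of_bijective_inner hr default)]
  congr 1
  ext x
  rw [mem_faceRegion_univ hr, Unique.forall_iff]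
  rfl

lemma stdGaussian_faceRegion_univ_two {i j : ι} (hall : ∀ m, m = i ∨ m = j)
    (hr : Function.Bijective fun (x : E) (j : ι) => ⟪r j, x⟫) :
    (stdGaussian E).real (faceRegion r Finset.univ) =
      1 / 2 - angle (r i) (r j) / (2 * Real.pi) := by
  rw [← stdGaussian_orthant_two (ne_zero_of_bijective_inner hr i)
    (ne_zero_of_bijective_inner hr j)]
  congr 1
  ext x
  rw [mem_faceRegion_univ hr]
  refine ⟨fun h => ⟨h i, h j⟩, fun h m => ?_⟩
  rcases hall m with rfl | rfl
  exacts [h.1, h.2]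

lemma stdGaussian_faceRegion_univ_three {i j k : ι} (hall : ∀ m, m = i ∨ m = j ∨ m = k)
    (hr : Function.Bijective fun (x : E) (j : ι) => ⟪r j, x⟫) :
    (stdGaussian E).real (faceRegion r Finset.univ) = 1 / (4 * Real.pi) *
      (2 * Real.pi - angle (r i) (r j) - angle (r i) (r k) - angle (r j) (r k)) := by
  rw [← stdGaussian_orthant_three (ne_zero_of_bijective_inner hr i)
    (ne_zero_of_bijective_inner hr j) (ne_zero_of_bijective_inner hr k)]
  congr 1
  ext x
  rw [mem_faceRegion_univ hr]
  refine ⟨fun h => ⟨h i, h j, h k⟩, fun h m => ?_⟩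
  rcases hall m with rfl | rfl | rfl
  exacts [h.1, h.2.1, h.2.2]

omit [FiniteDimensional ℝ E] [MeasurableSpace E] [BorelSpace E] [Fintype ι] in
lemma angle_neg_residualVec {k : ι} (hk : r k ≠ 0) (j : ι) :
    angle (-r k) (residualVec r k j) = Real.pi / 2 := by
  rw [← inner_eq_zero_iff_angle_eq_pi_div_two, inner_neg_left, inner_residualVec _ _ hk, neg_zero]

lemma stdGaussian_faceRegion_erase_two [DecidableEq ι] {k j : ι} (hjk : j ≠ k)
    (hall : ∀ m, m = j ∨ m = k)
    (hr : Function.Bijective fun (x : E) (j : ι) => ⟪r j, x⟫) :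
    (stdGaussian E).real (faceRegion r (Finset.univ.erase k)) = 1 / 4 := by
  have hk := ne_zero_of_bijective_inner hr k
  have h := stdGaussian_orthant_two (neg_ne_zero.2 hk) (residualVec_ne_zero hr hjk)
  rw [angle_neg_residualVec hk] at h
  have hpi := Real.pi_pos
  trans 1 / 2 - Real.pi / 2 / (2 * Real.pi)
  · rw [← h]
    refine measureReal_congr ?_
    filter_upwards [ae_inner_nonpos_iff hk] with x hx
    refine propext ((mem_faceRegion_erase hr k).trans ?_)
    rw [hx]
    refine and_congr_right fun _ => ⟨fun h => h j hjk, fun h m hm => ?_⟩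
    rcases hall m with rfl | rfl
    exacts [h, absurd rfl hm]
  · field_simp
    norm_num

lemma stdGaussian_faceRegion_erase_three [DecidableEq ι] {i j k : ι} (hik : i ≠ k) (hjk : j ≠ k)
    (hall : ∀ m, m = i ∨ m = j ∨ m = k)
    (hr : Function.Bijective fun (x : E) (j : ι) => ⟪r j, x⟫) :
    (stdGaussian E).real (faceRegion r (Finset.univ.erase k)) =
      1 / (4 * Real.pi) * (Real.pi - angle (residualVec r k i) (residualVec r k j)) := by
  have hk := ne_zero_of_bijective_inner hr k
  have h := stdGaussian_orthant_three (neg_ne_zero.2 hk) (residualVec_ne_zero hr hik)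
    (residualVec_ne_zero hr hjk)
  rw [angle_neg_residualVec hk, angle_neg_residualVec hk] at h
  trans 1 / (4 * Real.pi) * (2 * Real.pi - Real.pi / 2 - Real.pi / 2 -
    angle (residualVec r k i) (residualVec r k j))
  · rw [← h]
    refine measureReal_congr ?_
    filter_upwards [ae_inner_nonpos_iff hk] with x hx
    refine propext ((mem_faceRegion_erase hr k).trans ?_)
    rw [hx]
    refine and_congr_right fun _ => ⟨fun h => ⟨h i hik, h j hjk⟩, fun h m hm => ?_⟩
    rcases hall m with rfl | rfl | rfl
    exacts [h.1, h.2, absurd rfl hm]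
  · ring

lemma stdGaussian_faceRegion_singleton_three [DecidableEq ι] {j k l : ι}
    (hkl : k ≠ l) (hjk : j ≠ k) (hjl : j ≠ l)
    (hall : ∀ m, m = j ∨ m = k ∨ m = l)
    (hr : Function.Bijective fun (x : E) (j : ι) => ⟪r j, x⟫) :
    (stdGaussian E).real (faceRegion r {j}) = 1 / (4 * Real.pi) * angle (r k) (r l) := by
  have hD := gram_two_pos hr hkl
  have hk := cofactorVec_ne_zero hr hkl
  have hl := cofactorVec_ne_zero hr hkl.symm
  set b := (⟪r k, r k⟫ * ⟪r l, r l⟫ - ⟪r k, r l⟫ ^ 2) • r j -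
          (⟪r j, r k⟫ • cofactorVec r k l + ⟪r j, r l⟫ • cofactorVec r l k) with hb
  -- `b` is orthogonal to `r k` and `r l`, hence to both cofactor vectors
  have hbk : ⟪r k, b⟫ = 0 := by
    rw [hb, inner_sub_right, inner_add_right, real_inner_smul_right, real_inner_smul_right,
      real_inner_smul_right, real_inner_comm (cofactorVec r k l), inner_cofactorVec_left,
      real_inner_comm (cofactorVec r l k), inner_cofactorVec_right, real_inner_comm (r j)]
    ring
  have hbl : ⟪r l, b⟫ = 0 := by
    rw [hb, inner_sub_right, inner_add_right, real_inner_smul_right, real_inner_smul_right,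
      real_inner_smul_right, real_inner_comm (cofactorVec r k l), inner_cofactorVec_right,
      real_inner_comm (cofactorVec r l k), inner_cofactorVec_left, real_inner_comm (r j),
      real_inner_comm (r k) (r l)]
    ring
  have hbck : ⟪cofactorVec r k l, b⟫ = 0 := by
    rw [cofactorVec, inner_sub_left, real_inner_smul_left, real_inner_smul_left, hbk, hbl]; ring
  have hbcl : ⟪cofactorVec r l k, b⟫ = 0 := by
    rw [cofactorVec, inner_sub_left, real_inner_smul_left, real_inner_smul_left, hbk, hbl]; ring
  have hb0 : b ≠ 0 := by
    obtain ⟨w, hw, hw'⟩ := exists_inner_eq_single hr j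
    intro h0
    have h1 : ⟪b, w⟫ = ⟪r k, r k⟫ * ⟪r l, r l⟫ - ⟪r k, r l⟫ ^ 2 := by
      rw [hb, cofactorVec, cofactorVec]
      simp only [inner_sub_left, inner_add_left, real_inner_smul_left, hw, hw' k hjk.symm,
        hw' l hjl.symm]
      ring
    rw [h0, inner_zero_left] at h1
    exact hD.ne h1
  have h := stdGaussian_orthant_three (neg_ne_zero.2 hk) (neg_ne_zero.2 hl) hb0
  have a1 : angle (-cofactorVec r k l) b = Real.pi / 2 := by
    rw [← inner_eq_zero_iff_angle_eq_pi_div_two, inner_neg_left, hbck, neg_zero]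
  have a2 : angle (-cofactorVec r l k) b = Real.pi / 2 := by
    rw [← inner_eq_zero_iff_angle_eq_pi_div_two, inner_neg_left, hbcl, neg_zero]
  rw [a1, a2, angle_neg_neg, angle_cofactorVec hr hkl] at h
  trans 1 / (4 * Real.pi) * (2 * Real.pi - (Real.pi - angle (r k) (r l)) - Real.pi / 2 -
    Real.pi / 2)
  · rw [← h]
    refine measureReal_congr ?_
    filter_upwards [ae_inner_nonpos_iff hk, ae_inner_nonpos_iff hl] with x hx hx'
    refine propext ((mem_faceRegion_singleton hr hkl hjk hjl hall).trans ?_)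
    rw [hx, hx']
    rfl
  · ring
end

/-! ### Whitening and the mixture representation -/

section
variable {p : ℕ} {V : Matrix (Fin p) (Fin p) ℝ}

/-- The square root of `V` as an operator. It maps the standard Gaussian vector to `N(0, V)` and the
Euclidean length to the length given by `V⁻¹`. -/
noncomputable def sqrtCLM (V : Matrix (Fin p) (Fin p) ℝ) :
    EuclideanSpace ℝ (Fin p) →L[ℝ] EuclideanSpace ℝ (Fin p) :=
  Matrix.toEuclideanCLM (𝕜 := ℝ) (CFC.sqrt V)

/-- The rows of the square root of `V`: the coordinates of `sqrtCLM V x` are `⟪sqrtRow V j, x⟫`, and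
the Gram matrix is `V`. -/
noncomputable def sqrtRow (V : Matrix (Fin p) (Fin p) ℝ) (j : Fin p) : EuclideanSpace ℝ (Fin p) :=
  sqrtCLM V (EuclideanSpace.single j 1)

lemma inner_sqrtCLM_left (x y : EuclideanSpace ℝ (Fin p)) :
    ⟪sqrtCLM V x, y⟫ = ⟪x, sqrtCLM V y⟫ := by
  have h : IsSelfAdjoint (sqrtCLM V) := (CFC.sqrt_nonneg V).isSelfAdjoint.map _
  nth_rewrite 1 [← h.adjoint_eq]
  exact ContinuousLinearMap.adjoint_inner_left _ _ _

lemma inner_sqrtRow (j : Fin p) (x : EuclideanSpace ℝ (Fin p)) :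
    ⟪sqrtRow V j, x⟫ = sqrtCLM V x j := by
  rw [sqrtRow, inner_sqrtCLM_left, EuclideanSpace.inner_single_left]
  simp

lemma sqrtCLM_sqrtCLM (hV : V.PosDef) (x : EuclideanSpace ℝ (Fin p)) :
    sqrtCLM V (sqrtCLM V x) = Matrix.toEuclideanCLM (𝕜 := ℝ) V x := by
  rw [sqrtCLM, ← ContinuousLinearMap.comp_apply, ← ContinuousLinearMap.mul_def, ← map_mul,
    CFC.sqrt_mul_sqrt_self _ hV.posSemidef.nonneg]

lemma inner_sqrtRow_sqrtRow (hV : V.PosDef) (i j : Fin p) :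
    ⟪sqrtRow V i, sqrtRow V j⟫ = V i j := by
  rw [sqrtRow, sqrtRow, inner_sqrtCLM_left, sqrtCLM_sqrtCLM hV, EuclideanSpace.inner_single_left]
  simp [Matrix.mulVec_single]

lemma isUnit_det_sqrt (hV : V.PosDef) : IsUnit (CFC.sqrt V).det := by
  have h := hV.det_pos
  rw [← CFC.sqrt_mul_sqrt_self V hV.posSemidef.nonneg, Matrix.det_mul] at h
  exact isUnit_iff_ne_zero.2 fun h0 => by simp [h0] at h

lemma bijective_sqrtCLM (hV : V.PosDef) : Function.Bijective (sqrtCLM V) := by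
  have h := isUnit_det_sqrt hV
  refine Function.bijective_iff_has_inverse.2
    ⟨Matrix.toEuclideanCLM (𝕜 := ℝ) (CFC.sqrt V)⁻¹, fun x => ?_, fun x => ?_⟩
  · rw [sqrtCLM, ← ContinuousLinearMap.comp_apply, ← ContinuousLinearMap.mul_def, ← map_mul,
      Matrix.nonsing_inv_mul _ h, map_one, one_apply_eq_self]
  · rw [sqrtCLM, ← ContinuousLinearMap.comp_apply, ← ContinuousLinearMap.mul_def, ← map_mul,
      Matrix.mul_nonsing_inv _ h, map_one, one_apply_eq_self]

lemma bijective_inner_sqrtRow (hV : V.PosDef) :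
    Function.Bijective fun (x : EuclideanSpace ℝ (Fin p)) (j : Fin p) => ⟪sqrtRow V j, x⟫ := by
  simp_rw [inner_sqrtRow]
  exact (WithLp.ofLp_bijective 2).comp (bijective_sqrtCLM hV)

lemma invQuad_sqrtCLM (hV : V.PosDef) (x : EuclideanSpace ℝ (Fin p)) :
    invQuad V (sqrtCLM V x) = ‖x‖ ^ 2 := by
  have h := isUnit_det_sqrt hV
  have hmat : CFC.sqrt V * (V⁻¹ * CFC.sqrt V) = 1 := by
    nth_rewrite 2 [← CFC.sqrt_mul_sqrt_self V hV.posSemidef.nonneg]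
    rw [Matrix.mul_inv_rev, Matrix.mul_assoc, Matrix.nonsing_inv_mul _ h, Matrix.mul_one,
      Matrix.mul_nonsing_inv _ h]
  have e : invQuad V (sqrtCLM V x) =
      ⟪sqrtCLM V x, Matrix.toEuclideanCLM (𝕜 := ℝ) V⁻¹ (sqrtCLM V x)⟫ := by
    rw [Matrix.inner_toEuclideanCLM]
    simp [invQuad]
  rw [e, inner_sqrtCLM_left, sqrtCLM, ← ContinuousLinearMap.comp_apply,
    ← ContinuousLinearMap.comp_apply, ← ContinuousLinearMap.mul_def, ← ContinuousLinearMap.mul_def,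
    ← map_mul, ← map_mul, mul_assoc, hmat, map_one, one_apply_eq_self,
    real_inner_self_eq_norm_sq]

lemma sqrtCLM_mem_orthant {x : EuclideanSpace ℝ (Fin p)} :
    sqrtCLM V x ∈ orthant p ↔ x ∈ polyCone (sqrtRow V) :=
  forall_congr' fun j => by rw [inner_sqrtRow]

lemma isOrthantProj_sqrtCLM_iff (hV : V.PosDef) {x ξ : EuclideanSpace ℝ (Fin p)} :
    IsOrthantProj V (sqrtCLM V x) (sqrtCLM V ξ) ↔ IsConeProj (polyCone (sqrtRow V)) x ξ := by
  have hq : ∀ w, invQuad V (sqrtCLM V x - sqrtCLM V w) = ‖x - w‖ ^ 2 := fun w => by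
    rw [← map_sub, invQuad_sqrtCLM hV]
  constructor
  · rintro ⟨hmem, hmin⟩
    obtain ⟨η, hη⟩ := exists_isConeProj_polyCone (sqrtRow V) x
    have h1 := hmin (sqrtCLM_mem_orthant.2 hη.1)
    simp only [Set.mem_ofPred_eq, hq] at h1
    rwa [hη.eq (sqrtCLM_mem_orthant.1 hmem) h1]
  · intro h
    refine ⟨sqrtCLM_mem_orthant.2 h.1, fun y hy => ?_⟩
    obtain ⟨w, rfl⟩ := (bijective_sqrtCLM hV).2 y
    have h1 := h.isMinOn (sqrtCLM_mem_orthant.1 hy)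
    simpa only [Set.mem_ofPred_eq, hq] using h1

lemma existsUnique_isOrthantProj (hV : V.PosDef) (z : EuclideanSpace ℝ (Fin p)) :
    ∃! ζ, IsOrthantProj V z ζ := by
  obtain ⟨x, rfl⟩ := (bijective_sqrtCLM hV).2 z
  obtain ⟨ξ, hξ⟩ := exists_isConeProj_polyCone (sqrtRow V) x
  refine ⟨sqrtCLM V ξ, (isOrthantProj_sqrtCLM_iff hV).2 hξ, fun ζ hζ => ?_⟩
  obtain ⟨η, rfl⟩ := (bijective_sqrtCLM hV).2 ζ
  rw [hξ.unique ((isOrthantProj_sqrtCLM_iff hV).1 hζ)]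

lemma chiBarStat_sqrtCLM (hV : V.PosDef) {x ξ : EuclideanSpace ℝ (Fin p)}
    (h : IsConeProj (polyCone (sqrtRow V)) x ξ) : chiBarStat V (sqrtCLM V x) = ‖ξ‖ ^ 2 := by
  obtain ⟨hmem, hmin⟩ := (isOrthantProj_sqrtCLM_iff hV).2 h
  rw [chiBarStat, hmin.iInf_eq hmem, ← map_sub, invQuad_sqrtCLM hV, invQuad_sqrtCLM hV,
    h.norm_sub_sq]

lemma multivariateGaussian_real_eq (hV : V.PosDef) (s : Set (EuclideanSpace ℝ (Fin p))) :
    (multivariateGaussian 0 V).real s =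
      (stdGaussian (EuclideanSpace ℝ (Fin p))).real {x | sqrtCLM V x ∈ s} := by
  have he : MeasurableEmbedding (sqrtCLM V) :=
    (sqrtCLM V).continuous.measurableEmbedding (bijective_sqrtCLM hV).1
  have : multivariateGaussian 0 V =
      (stdGaussian (EuclideanSpace ℝ (Fin p))).map (sqrtCLM V) := by
    simp only [multivariateGaussian, zero_add]
    rfl
  rw [this, measureReal_def, he.map_apply]
  rfl

lemma projWeight_eq_sum (hV : V.PosDef) (i : ℕ) :
    projWeight V i = ∑ S : Finset (Fin p) with S.card = i,
      (stdGaussian (EuclideanSpace ℝ (Fin p))).real (faceRegion (sqrtRow V) S) := by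
  rw [projWeight, multivariateGaussian_real_eq hV, ← stdGaussian_coneProj_card]
  congr 1
  ext x
  constructor
  · rintro ⟨ζ, ⟨hmem, hcard⟩, hζ⟩
    obtain ⟨ξ, rfl⟩ := (bijective_sqrtCLM hV).2 ζ
    refine ⟨ξ, (isOrthantProj_sqrtCLM_iff hV).1 hζ, ?_⟩
    simp_rw [inner_sqrtRow]
    exact hcard
  · rintro ⟨ξ, hξ, hcard⟩
    have h := (isOrthantProj_sqrtCLM_iff hV).2 hξ
    refine ⟨sqrtCLM V ξ, ⟨h.1, ?_⟩, h⟩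
    simp_rw [inner_sqrtRow] at hcard
    exact hcard

lemma sum_mul_card_eq {p : ℕ} (f : Finset (Fin p) → ℝ) (g : ℕ → ℝ) :
    ∑ S : Finset (Fin p), f S * g S.card =
      ∑ i : Fin (p + 1), (∑ S : Finset (Fin p) with S.card = (i : ℕ), f S) * g i := by
  have hcard : ∀ S : Finset (Fin p), S.card < p + 1 := fun S =>
    Nat.lt_succ_of_le ((Finset.card_le_univ S).trans_eq (Fintype.card_fin p))
  rw [← Finset.sum_fiberwise Finset.univ
    (fun S : Finset (Fin p) => (⟨S.card, hcard S⟩ : Fin (p + 1)))]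
  refine Finset.sum_congr rfl fun i _ => ?_
  rw [Finset.sum_mul]
  refine Finset.sum_congr ?_ fun S hS => ?_
  · ext S; simp [Fin.ext_iff]
  · rw [(Finset.mem_filter.1 hS).2]

lemma isChiBarSquareWeights_projWeight (hV : V.PosDef) :
    IsChiBarSquareWeights V fun i => projWeight V i := by
  constructor
  · simp_rw [projWeight_eq_sum hV]
    rw [← sum_stdGaussian_faceRegion (sqrtRow V)]
    simpa using (sum_mul_card_eq (fun S => (stdGaussian (EuclideanSpace ℝ (Fin p))).real
      (faceRegion (sqrtRow V) S)) fun _ => 1).symm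
  · intro x
    simp_rw [projWeight_eq_sum hV]
    rw [← sum_mul_card_eq _ fun k => (chiSquareLaw k).real (Set.Iic x),
      ← stdGaussian_norm_coneProj_le (bijective_inner_sqrtRow hV), multivariateGaussian_real_eq hV]
    congr 1
    ext y
    obtain ⟨ξ, hξ⟩ := exists_isConeProj_polyCone (sqrtRow V) y
    change chiBarStat V (sqrtCLM V y) ≤ x ↔ _
    rw [chiBarStat_sqrtCLM hV hξ]
    refine ⟨fun h => ⟨ξ, hξ, h⟩, ?_⟩
    rintro ⟨η, hη, hle⟩
    rwa [← hξ.unique hη]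

lemma isChiBarSquareWeights_iff (hV : V.PosDef) (w : Fin (p + 1) → ℝ) :
    IsChiBarSquareWeights V w ↔ ∀ i, w i = projWeight V i := by
  have hW := isChiBarSquareWeights_projWeight hV
  constructor
  · intro h i
    have := chiSquareLaw_linearIndependent (fun i => w i - projWeight V i) fun x => by
      simp_rw [sub_mul, Finset.sum_sub_distrib]
      rw [← h.2 x, ← hW.2 x, sub_self]
    exact sub_eq_zero.1 (congrFun this i)
  · intro h
    rwa [funext h]

lemma sum_projWeight (hV : V.PosDef) : ∑ i : Fin (p + 1), projWeight V i = 1 :=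
  (isChiBarSquareWeights_projWeight hV).1

lemma arccos_corr (hV : V.PosDef) (i j : Fin p) :
    Real.arccos (corr V i j) = angle (sqrtRow V i) (sqrtRow V j) := by
  rw [angle, corr, ← inner_sqrtRow_sqrtRow hV i j, ← inner_sqrtRow_sqrtRow hV i i,
    ← inner_sqrtRow_sqrtRow hV j j, real_inner_self_eq_norm_sq, real_inner_self_eq_norm_sq,
    ← mul_pow, Real.sqrt_sq (by positivity)]

lemma arccos_partialCorr (hV : V.PosDef) (i j k : Fin p) :
    Real.arccos (partialCorr V i j k) =
      angle (residualVec (sqrtRow V) k i) (residualVec (sqrtRow V) k j) := by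
  have hn : ∀ m, 0 < ‖sqrtRow V m‖ := fun m =>
    norm_pos_iff.2 (ne_zero_of_bijective_inner (bijective_inner_sqrtRow hV) m)
  have hc : ∀ a b, corr V a b = ⟪sqrtRow V a, sqrtRow V b⟫ / (‖sqrtRow V a‖ * ‖sqrtRow V b‖) := by
    intro a b
    rw [corr, ← inner_sqrtRow_sqrtRow hV a b, ← inner_sqrtRow_sqrtRow hV a a,
      ← inner_sqrtRow_sqrtRow hV b b, real_inner_self_eq_norm_sq, real_inner_self_eq_norm_sq,
      ← mul_pow, Real.sqrt_sq (by positivity)]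
  set r := sqrtRow V
  have hk := hn k
  have hres : ∀ a b, ⟪residualVec r k a, residualVec r k b⟫ =
      ‖r a‖ * ‖r b‖ * (corr V a b - corr V a k * corr V b k) := by
    intro a b
    have ha := hn a
    have hb := hn b
    rw [hc, hc, hc, residualVec, residualVec, inner_sub_left, inner_sub_right, inner_sub_right,
      real_inner_smul_left, real_inner_smul_right, real_inner_smul_left, real_inner_smul_right,
      real_inner_comm (r b) (r k), real_inner_self_eq_norm_sq]
    field_simp
    ring
  have hself : ∀ a, corr V a a = 1 := fun a => by
    have ha := hn a
    rw [hc, real_inner_self_eq_norm_sq]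
    field_simp
  have hnorm : ∀ a, ‖residualVec r k a‖ = ‖r a‖ * √(1 - corr V a k ^ 2) := by
    intro a
    rw [norm_eq_sqrt_real_inner, hres, hself, ← sq, ← sq, Real.sqrt_mul (sq_nonneg _),
      Real.sqrt_sq (hn a).le]
  have h1 : 0 ≤ 1 - corr V i k ^ 2 := by
    have : 0 ≤ ‖r i‖ * ‖r i‖ * (corr V i i - corr V i k * corr V i k) := by
      rw [← hres]; exact real_inner_self_nonneg
    rw [hself] at this
    have := nonneg_of_mul_nonneg_right this (mul_pos (hn i) (hn i))
    linarith
  rw [angle, hres, hnorm, hnorm, partialCorr, Real.sqrt_mul h1]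
  congr 1
  have hi := hn i
  have hj := hn j
  rw [show ‖r i‖ * √(1 - corr V i k ^ 2) * (‖r j‖ * √(1 - corr V j k ^ 2)) =
    ‖r i‖ * ‖r j‖ * (√(1 - corr V i k ^ 2) * √(1 - corr V j k ^ 2)) by ring,
    mul_div_mul_left _ _ (mul_pos hi hj).ne']
end

/-! ### Positive definiteness of the covariance matrix and the explicit weights -/

lemma det_diffMatrix (p : ℕ) : (diffMatrix p).det = 1 := by
  have h : (diffMatrix p).BlockTriangular id := by
    intro i j hij
    have h1 : j ≠ i := ne_of_lt hij
    have h2 : (j : ℕ) ≠ i + 1 := by have : (j : ℕ) < i := hij; omega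
    simp [diffMatrix, h1, h2]
  rw [Matrix.det_of_isUpperTriangular h]
  simp [diffMatrix]

lemma posDef_covV {p : ℕ} {ν : Fin (p + 1) → ℝ} (hν : ∀ i, 0 < ν i) : (covV ν).PosDef := by
  have h1 : (Matrix.diagonal fun i : Fin p => ν i.castSucc)⁻¹.PosDef :=
    (Matrix.PosDef.diagonal fun i => hν _).inv
  have hunit : IsUnit (diffMatrix p) := by
    rw [Matrix.isUnit_iff_isUnit_det, det_diffMatrix]; exact isUnit_one
  have h2 := h1.mul_mul_conjTranspose_same (B := diffMatrix p)
    (Matrix.vecMul_injective_of_isUnit hunit)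
  rw [Matrix.conjTranspose_eq_transpose_of_trivial] at h2
  have h3 : (Matrix.vecMulVec (lastUnit p) (lastUnit p)).PosSemidef := by
    simpa using Matrix.posSemidef_vecMulVec_self_star (lastUnit p)
  exact h2.add_posSemidef (h3.smul (one_div_pos.2 (hν _)).le)

lemma projWeight_dim_one {V : Matrix (Fin 1) (Fin 1) ℝ} (hV : V.PosDef) :
    projWeight V 0 = 1 / 2 ∧ projWeight V 1 = 1 / 2 := by
  have h1 : projWeight V 1 = 1 / 2 := by
    have hf : (Finset.univ.filter fun S : Finset (Fin 1) => S.card = 1) = {Finset.univ} := by decide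
    rw [projWeight_eq_sum hV, hf, Finset.sum_singleton,
      stdGaussian_faceRegion_univ_one (bijective_inner_sqrtRow hV)]
  have h := sum_projWeight hV
  rw [Fin.sum_univ_two] at h
  simp only [Fin.val_zero, Fin.val_one] at h
  exact ⟨by linarith, h1⟩

lemma projWeight_dim_two {V : Matrix (Fin 2) (Fin 2) ℝ} (hV : V.PosDef) :
    projWeight V 0 = 1 / (2 * Real.pi) * Real.arccos (corr V 0 1) ∧
    projWeight V 1 = 1 / 2 ∧
    projWeight V 2 = 1 / 2 - 1 / (2 * Real.pi) * Real.arccos (corr V 0 1) := by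
  have hr := bijective_inner_sqrtRow hV
  have h2 : projWeight V 2 = 1 / 2 - 1 / (2 * Real.pi) * Real.arccos (corr V 0 1) := by
    have hf : (Finset.univ.filter fun S : Finset (Fin 2) => S.card = 2) = {Finset.univ} := by decide
    rw [projWeight_eq_sum hV, hf, Finset.sum_singleton, arccos_corr hV,
      stdGaussian_faceRegion_univ_two (i := 0) (j := 1) (by decide) hr]
    ring
  have h1 : projWeight V 1 = 1 / 2 := by
    have hf : (Finset.univ.filter fun S : Finset (Fin 2) => S.card = 1) =
        {Finset.univ.erase 0, Finset.univ.erase 1} := by decide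
    rw [projWeight_eq_sum hV, hf, Finset.sum_pair (by decide),
      stdGaussian_faceRegion_erase_two (k := 0) (j := 1) (by decide) (by decide) hr,
      stdGaussian_faceRegion_erase_two (k := 1) (j := 0) (by decide) (by decide) hr]
    norm_num
  have h := sum_projWeight hV
  rw [Fin.sum_univ_three] at h
  simp only [Fin.val_zero, Fin.val_one, Fin.val_two] at h
  exact ⟨by linarith, h1, h2⟩

lemma projWeight_dim_three {V : Matrix (Fin 3) (Fin 3) ℝ} (hV : V.PosDef) :
    projWeight V 3 = 1 / (4 * Real.pi) * (2 * Real.pi - Real.arccos (corr V 0 1)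
        - Real.arccos (corr V 0 2) - Real.arccos (corr V 1 2)) ∧
      projWeight V 2 = 1 / (4 * Real.pi) * (3 * Real.pi
        - Real.arccos (partialCorr V 0 1 2) - Real.arccos (partialCorr V 0 2 1)
        - Real.arccos (partialCorr V 1 2 0)) ∧
      projWeight V 1 = 1 / 2 - projWeight V 3 ∧
      projWeight V 0 = 1 / 2 - projWeight V 2 := by
  have hr := bijective_inner_sqrtRow hV
  have hpi := Real.pi_pos
  have h3 : projWeight V 3 = 1 / (4 * Real.pi) * (2 * Real.pi - Real.arccos (corr V 0 1)
        - Real.arccos (corr V 0 2) - Real.arccos (corr V 1 2)) := by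
    have hf : (Finset.univ.filter fun S : Finset (Fin 3) => S.card = 3) = {Finset.univ} := by decide
    rw [projWeight_eq_sum hV, hf, Finset.sum_singleton, arccos_corr hV, arccos_corr hV,
      arccos_corr hV,
      stdGaussian_faceRegion_univ_three (i := 0) (j := 1) (k := 2) (by decide) hr]
  have h2 : projWeight V 2 = 1 / (4 * Real.pi) * (3 * Real.pi
        - Real.arccos (partialCorr V 0 1 2) - Real.arccos (partialCorr V 0 2 1)
        - Real.arccos (partialCorr V 1 2 0)) := by
    have hf : (Finset.univ.filter fun S : Finset (Fin 3) => S.card = 2) =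
        {Finset.univ.erase 2, Finset.univ.erase 1, Finset.univ.erase 0} := by decide
    rw [projWeight_eq_sum hV, hf, Finset.sum_insert (by decide), Finset.sum_pair (by decide),
      stdGaussian_faceRegion_erase_three (k := 2) (i := 0) (j := 1) (by decide) (by decide)
        (by decide) hr,
      stdGaussian_faceRegion_erase_three (k := 1) (i := 0) (j := 2) (by decide) (by decide)
        (by decide) hr,
      stdGaussian_faceRegion_erase_three (k := 0) (i := 1) (j := 2) (by decide) (by decide)
        (by decide) hr,
      arccos_partialCorr hV, arccos_partialCorr hV, arccos_partialCorr hV]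
    ring
  have h1 : projWeight V 1 = 1 / 2 - projWeight V 3 := by
    have hf : (Finset.univ.filter fun S : Finset (Fin 3) => S.card = 1) = {{0}, {1}, {2}} := by
      decide
    rw [h3, projWeight_eq_sum hV, hf, Finset.sum_insert (by decide), Finset.sum_pair (by decide),
      stdGaussian_faceRegion_singleton_three (j := 0) (k := 1) (l := 2) (by decide) (by decide)
        (by decide) (by decide) hr,
      stdGaussian_faceRegion_singleton_three (j := 1) (k := 0) (l := 2) (by decide) (by decide)
        (by decide) (by decide) hr,
      stdGaussian_faceRegion_singleton_three (j := 2) (k := 0) (l := 1) (by decide) (by decide)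
        (by decide) (by decide) hr,
      arccos_corr hV, arccos_corr hV, arccos_corr hV]
    field_simp
    ring
  have h := sum_projWeight hV
  rw [Fin.sum_univ_four] at h
  simp only [Fin.val_zero, Fin.val_one, Fin.val_two] at h
  have h' : projWeight V 0 + projWeight V 1 + projWeight V 2 + projWeight V 3 = 1 := h
  exact ⟨h3, h2, h1, by linarith⟩

theorem theorem3 :
    -- the weights, for `I = p + 1` groups
    (∀ (p : ℕ) (ν : Fin (p + 1) → ℝ), IsProportions ν →
      (covV ν).PosDef ∧
      (∀ z, ∃! ζ, IsOrthantProj (covV ν) z ζ) ∧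
      (∀ w : Fin (p + 1) → ℝ,
        IsChiBarSquareWeights (covV ν) w ↔ ∀ i, w i = projWeight (covV ν) i)) ∧
    -- `I = 2`
    (∀ ν : Fin 2 → ℝ, IsProportions ν →
      projWeight (covV ν) 0 = 1 / 2 ∧
      projWeight (covV ν) 1 = 1 / 2) ∧
    -- `I = 3`
    (∀ ν : Fin 3 → ℝ, IsProportions ν →
      projWeight (covV ν) 0 = 1 / (2 * Real.pi) * Real.arccos (corr (covV ν) 0 1) ∧
      projWeight (covV ν) 1 = 1 / 2 ∧
      projWeight (covV ν) 2 = 1 / 2 - 1 / (2 * Real.pi) * Real.arccos (corr (covV ν) 0 1)) ∧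
    -- `I = 4`
    (∀ ν : Fin 4 → ℝ, IsProportions ν →
      projWeight (covV ν) 3 = 1 / (4 * Real.pi) * (2 * Real.pi - Real.arccos (corr (covV ν) 0 1)
        - Real.arccos (corr (covV ν) 0 2) - Real.arccos (corr (covV ν) 1 2)) ∧
      projWeight (covV ν) 2 = 1 / (4 * Real.pi) * (3 * Real.pi
        - Real.arccos (partialCorr (covV ν) 0 1 2) - Real.arccos (partialCorr (covV ν) 0 2 1)
        - Real.arccos (partialCorr (covV ν) 1 2 0)) ∧
      projWeight (covV ν) 1 = 1 / 2 - projWeight (covV ν) 3 ∧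
      projWeight (covV ν) 0 = 1 / 2 - projWeight (covV ν) 2) := by
  exact ⟨fun _ _ hν => ⟨posDef_covV hν.1, existsUnique_isOrthantProj (posDef_covV hν.1),
      isChiBarSquareWeights_iff (posDef_covV hν.1)⟩,
    fun _ hν => projWeight_dim_one (posDef_covV hν.1),
    fun _ hν => projWeight_dim_two (posDef_covV hν.1),
    fun _ hν => projWeight_dim_three (posDef_covV hν.1)⟩
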